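/- Let $n,m,l\ge 0$ and $r\ge 1$ be integers, $A_0,\dots,A_{r-1}\in\mathbb R^{n\times n}$, $B_0,\dots,B_{r-1}\in\mathbb R^{n\times m}$, $Q\in\mathbb R^{n\times n}$, $L\in\mathbb R^{n\times m}$, $R\in\mathbb R^{m\times m}$, $C\in\mathbb R^{l\times n}$ with $\begin{bmatrix}Q&L\\L^{\mathrm T}&R\end{bmatrix}\succeq0$, $R\succ0$ and $C^{\mathrm T}C=Q-LR^{-1}L^{\mathrm T}$. ($\succ0$, $\succeq 0$ mean symmetric positive definite, positive semidefinite (PSD); $Z_1\succeq Z_2$ means $Z_1-Z_2\succeq0$.) For $F\in\mathbb R^{m\times n}$ let $\mathcal S_F:\mathbb R^{n\times n}\to\mathbb R^{n\times n}$, $\mathcal S_F(S)=\sum_{i=0}^{r-1}(A_i+B_iF)S(A_i+B_iF)^{\mathrm T}$, with adjoint $\mathcal S_F^*(S)=\sum_{i=0}^{r-1}(A_i+B_iF)^{\mathrm T}S(A_i+B_iF)$; $\rho$ denotes the spectral radius. Assume: * $(\{A_i\},\{B_i\})$ is stabilizable: $\rho(\mathcal S_F)<1$ for some $F\in\mathbb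 R^{m\times n}$; * with $\hat A_i=A_i-B_iR^{-1}L^{\mathrm T}$, the pair $(\{\hat A_i\},C)$ is detectable, i.e. $(\{\hat A_i^{\mathrm T}\},\{C_i^{\mathrm T}\})$ is stabilizable, where $C_0=C$ and $C_i=0$ for $i\ge1$. Let $\Pi$ be the permutation matrix with $\Pi^{\mathrm T}(X\otimes I_r)\Pi=I_r\otimes X$ for all $X\in\mathbb R^{n\times n}$, and put $$A=\Pi\begin{bmatrix}\hat A_0\\\vdots\\\hat A_{r-1}\end{bmatrix}\in\mathbb R^{rn\times n},\qquad B=\Pi\begin{bmatrix}B_0\\\vdots\\B_{r-1}\end{bmatrix}R^{-1/2}\in\mathbb R^{rn\times m}.$$ Let $\ltimes$ be the left semi-tensor product: $M\ltimes X=M(X\otimes I_r)$ if $M$ has $rn$ columns and $X$ has $n$ rows, and the usual product if the sizes match. Consider the SDARE $X=\mathcal D(X)$ with $$\mathcal D(X)=A^{\mathrm T}\ltimes X\ltimes(I_{rn}+BB^{\mathrm T}\ltimes X)^{-1}\ltimes A+C^{\mathrm T}C ,$$ and the iteration $X_0=0$, $X_{t+1}=\mathcal D(X_t)$. A solution $X\succeq0$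 of $X=\mathcal D(X)$ is called stabilizing if $\rho(\mathcal S_{F_X})<1$, where $F_X=-\big(\sum_iB_i^{\mathrm T}XB_i+R\big)^{-1}\big(\sum_iA_i^{\mathrm T}XB_i+L\big)^{\mathrm T}$. Then: 1. For every $Z\succeq0$ the inverse in $\mathcal D(Z)$ exists, and if $Z_1\succeq0$, $Z_2\succeq0$ and $Z_1\succeq Z_2$, then $\mathcal D(Z_1)\succeq\mathcal D(Z_2)$. 2. The SDARE has a unique PSD stabilizing solution $X_\star$. The sequence $(X_t)$ is nondecreasing ($X_{t+1}\succeq X_t$) and converges to $X_\star$. Moreover, either it terminates ($X_t=X_\star$ for all sufficiently large $t$), or $X_{t+1}\succeq X_t$ and $X_{t+1}\ne X_t$ for every $t$. 3. The convergence is R-linear: with $F_\star=F_{X_\star}$, there is $Y\in\mathbb R^{n\times n}$, $Y\succ0$, such that $I_n-YX_\star$ is invertible and, for all $t\ge 0$, $$X_t\succeq X_\star-(\mathcal S_{F_\star}^*)^t\big(X_\star(I_n-YX_\star)^{-1}\big).$$ Moreover $\rho(\mathcal S_{F_\star})<1$, and if $X_\star\ne0$ then the following limit exists and satisfies $$\lim_{t\to\infty}\left(\frac{\|X_t-X_\star\|}{\|X_\star\|}\right)^{1/t}\le\rho(\mathcal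 S_{F_\star}),$$ where $\|\cdot\|$ is the matrix norm induced by the Euclidean norm. -/

import Mathlib

open Matrix Filter Topology
open scoped Kronecker TensorProduct

noncomputable section

namespace SDARE

/-- The spectral radius `ρ(T)` of an endomorphism of a real vector space: the supremum of the moduli
of the complex spectral values of `T`, i.e. of the spectrum of its complexification. -/
def opSpectralRadius {V : Type*} [AddCommGroup V] [Module ℝ V] (T : V →ₗ[ℝ] V) : ENNReal :=
  spectralRadius ℂ (T.baseChange ℂ : Module.End ℂ (ℂ ⊗[ℝ] V))

/-- The norm of a square matrix induced by the Euclidean vector norm. -/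
def inducedNorm {n : ℕ} (X : Matrix (Fin n) (Fin n) ℝ) : ℝ :=
  ‖Matrix.toEuclideanCLM (n := Fin n) (𝕜 := ℝ) X‖

/-- The generalized Lyapunov (Stein) operator of matrices `M 0, …, M (r-1)`:
`S ↦ [M₀ ⋯ M_{r-1}] (I_r ⊗ S) [M₀ ⋯ M_{r-1}]ᵀ = ∑ i, Mᵢ S Mᵢᵀ`, on all of `ℝ^{n×n}`. -/
def steinOp {n r : ℕ} (M : Fin r → Matrix (Fin n) (Fin n) ℝ) :
    Matrix (Fin n) (Fin n) ℝ →ₗ[ℝ] Matrix (Fin n) (Fin n) ℝ where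
  toFun S := ∑ i, M i * S * (M i)ᵀ
  map_add' S T := by
    simp only [Matrix.mul_add, Matrix.add_mul, Finset.sum_add_distrib]
  map_smul' c S := by
    simp only [Matrix.mul_smul, Matrix.smul_mul, Finset.smul_sum, RingHom.id_apply]

/-- The adjoint of `steinOp M` for the inner product `⟨S, T⟩ = tr (Sᵀ T)` (see
`trace_steinOp_mul`): `S ↦ ∑ i, Mᵢᵀ S Mᵢ`. -/
def steinOpAdjoint {n r : ℕ} (M : Fin r → Matrix (Fin n) (Fin n) ℝ) :
    Matrix (Fin n) (Fin n) ℝ →ₗ[ℝ] Matrix (Fin n) (Fin n) ℝ :=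
  steinOp fun i => (M i)ᵀ

theorem trace_steinOp_mul {n r : ℕ} (M : Fin r → Matrix (Fin n) (Fin n) ℝ)
    (S T : Matrix (Fin n) (Fin n) ℝ) :
    ((steinOp M S)ᵀ * T).trace = (Sᵀ * steinOpAdjoint M T).trace := by
  simp only [steinOpAdjoint, steinOp, LinearMap.coe_mk, AddHom.coe_mk, Matrix.transpose_sum,
    Matrix.sum_mul, Matrix.mul_sum, Matrix.trace_sum, Matrix.transpose_mul,
    Matrix.transpose_transpose]
  refine Finset.sum_congr rfl fun i _ => ?_
  rw [Matrix.mul_assoc, Matrix.trace_mul_comm]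
  simp only [Matrix.mul_assoc]

/-- The closed-loop matrices `Aᵢ + Bᵢ F`. -/
def closedLoop {n m r : ℕ} (A : Fin r → Matrix (Fin n) (Fin n) ℝ)
    (B : Fin r → Matrix (Fin n) (Fin m) ℝ) (F : Matrix (Fin m) (Fin n) ℝ) :
    Fin r → Matrix (Fin n) (Fin n) ℝ :=
  fun i => A i + B i * F

/-- `(A, B)` is stabilizable: some feedback `F` makes `S_F : S ↦ ∑ i, (Aᵢ+BᵢF) S (Aᵢ+BᵢF)ᵀ`
exponentially stable, i.e. `ρ(S_F) < 1`. -/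
def Stabilizable {n m r : ℕ} (A : Fin r → Matrix (Fin n) (Fin n) ℝ)
    (B : Fin r → Matrix (Fin n) (Fin m) ℝ) : Prop :=
  ∃ F : Matrix (Fin m) (Fin n) ℝ, opSpectralRadius (steinOp (closedLoop A B F)) < 1

/-- `(A, C)` is detectable: `((Aᵢᵀ)ᵢ, (Cᵢᵀ)ᵢ)` is stabilizable, where `C₀ = C` and `Cᵢ = 0`
for `i ≠ 0`. -/
def Detectable {n l r : ℕ} [NeZero r] (A : Fin r → Matrix (Fin n) (Fin n) ℝ)
    (C : Matrix (Fin l) (Fin n) ℝ) : Prop :=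
  Stabilizable (fun i => (A i)ᵀ) (fun i => if i = 0 then Cᵀ else 0)

/-- Left semi-tensor product `M ⋉ X = M (X ⊗ I_r)` of a matrix `M` with `n r` columns and a matrix
`X` with `n` rows. An index set of size `n r` is written as a product of index sets of
sizes `n` and `r`. All the other semi-tensor products below are between factors of matching size,
where `⋉` is the usual matrix product. -/
def ltimes {a b : Type*} {n r : ℕ} [Fintype b] (M : Matrix a (Fin n × Fin r) ℝ)
    (X : Matrix (Fin n) b ℝ) : Matrix a (b × Fin r) ℝ :=
  M * (X ⊗ₖ (1 : Matrix (Fin r) (Fin r) ℝ))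

/-- `Π M̃`, where `M̃` is the stacked matrix with blocks `M₀, …, M_{r-1}` and `Π` is the
permutation with `Πᵀ (X ⊗ I_r) Π = I_r ⊗ X` for all `X`: its row `(j, i)` is row `j` of `Mᵢ`. -/
def permStack {n k r : ℕ} (M : Fin r → Matrix (Fin n) (Fin k) ℝ) :
    Matrix (Fin n × Fin r) (Fin k) ℝ :=
  Matrix.of fun p j => M p.2 p.1 j

/-- Blocks of `Ã - B̃ R⁻¹ Lᵀ`. -/
def stdABlocks {n m r : ℕ} (A : Fin r → Matrix (Fin n) (Fin n) ℝ)
    (B : Fin r → Matrix (Fin n) (Fin m) ℝ) (L : Matrix (Fin n) (Fin m) ℝ)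
    (R : Matrix (Fin m) (Fin m) ℝ) : Fin r → Matrix (Fin n) (Fin n) ℝ :=
  fun i => A i - B i * R⁻¹ * Lᵀ

/-- Coefficient `A = Π (Ã - B̃ R⁻¹ Lᵀ)` of the standard form. -/
def stdA {n m r : ℕ} (A : Fin r → Matrix (Fin n) (Fin n) ℝ)
    (B : Fin r → Matrix (Fin n) (Fin m) ℝ) (L : Matrix (Fin n) (Fin m) ℝ)
    (R : Matrix (Fin m) (Fin m) ℝ) : Matrix (Fin n × Fin r) (Fin n) ℝ :=
  permStack (stdABlocks A B L R)

open scoped MatrixOrder in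
/-- Coefficient `B = Π B̃ R^{-1/2}` of the standard form. -/
def stdB {n m r : ℕ} (B : Fin r → Matrix (Fin n) (Fin m) ℝ)
    (R : Matrix (Fin m) (Fin m) ℝ) : Matrix (Fin n × Fin r) (Fin m) ℝ :=
  permStack B * (CFC.sqrt R)⁻¹

/-- The operator of the standard form,
`D(X) = Aᵀ ⋉ X ⋉ (I + B Bᵀ ⋉ X)⁻¹ ⋉ A + Cᵀ C`. -/
def riccatiOp {n m l r : ℕ} (A : Matrix (Fin n × Fin r) (Fin n) ℝ)
    (B : Matrix (Fin n × Fin r) (Fin m) ℝ) (C : Matrix (Fin l) (Fin n) ℝ)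
    (X : Matrix (Fin n) (Fin n) ℝ) : Matrix (Fin n) (Fin n) ℝ :=
  ltimes Aᵀ X * (1 + ltimes (B * Bᵀ) X)⁻¹ * A + Cᵀ * C

/-- Fixed point iteration `X₀ = 0`, `X_{t+1} = D(X_t)`. -/
def fixedPointIter {n m l r : ℕ} (A : Matrix (Fin n × Fin r) (Fin n) ℝ)
    (B : Matrix (Fin n × Fin r) (Fin m) ℝ) (C : Matrix (Fin l) (Fin n) ℝ) :
    ℕ → Matrix (Fin n) (Fin n) ℝ
  | 0 => 0
  | t + 1 => riccatiOp A B C (fixedPointIter A B C t)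

/-- `F_X = -(∑ Bᵢᵀ X Bᵢ + R)⁻¹ (∑ Aᵢᵀ X Bᵢ + L)ᵀ`. -/
def feedback {n m r : ℕ} (A : Fin r → Matrix (Fin n) (Fin n) ℝ)
    (B : Fin r → Matrix (Fin n) (Fin m) ℝ) (L : Matrix (Fin n) (Fin m) ℝ)
    (R : Matrix (Fin m) (Fin m) ℝ) (X : Matrix (Fin n) (Fin n) ℝ) : Matrix (Fin m) (Fin n) ℝ :=
  -((∑ i, (B i)ᵀ * X * B i + R)⁻¹ * (∑ i, (A i)ᵀ * X * B i + L)ᵀ)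

/-- The matrices `Aᵢ + Bᵢ F_X`, so that `S_{F_X} = steinOp (feedbackLoop A B L R X)`. -/
def feedbackLoop {n m r : ℕ} (A : Fin r → Matrix (Fin n) (Fin n) ℝ)
    (B : Fin r → Matrix (Fin n) (Fin m) ℝ) (L : Matrix (Fin n) (Fin m) ℝ)
    (R : Matrix (Fin m) (Fin m) ℝ) (X : Matrix (Fin n) (Fin n) ℝ) :
    Fin r → Matrix (Fin n) (Fin n) ℝ :=
  closedLoop A B (feedback A B L R X)

/-- `X` is a positive semi-definite stabilizing solution of `X = D(X)`: `X ⪰ 0`, `D(X) = X` and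
`S_{F_X}` is exponentially stable. -/
structure IsPSDStabilizingSolution {n m l r : ℕ} (A : Fin r → Matrix (Fin n) (Fin n) ℝ)
    (B : Fin r → Matrix (Fin n) (Fin m) ℝ) (L : Matrix (Fin n) (Fin m) ℝ)
    (R : Matrix (Fin m) (Fin m) ℝ) (C : Matrix (Fin l) (Fin n) ℝ)
    (X : Matrix (Fin n) (Fin n) ℝ) : Prop where
  posSemidef : X.PosSemidef
  solution : riccatiOp (stdA A B L R) (stdB B R) C X = X
  stabilizing : opSpectralRadius (steinOp (feedbackLoop A B L R X)) < 1

end SDARE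

end

/-!
The Riccati operator is a pointwise minimum over feedbacks: with `X̃ = X ⊗ I_r`, completing the
square (`SDARE.cost_eq`) gives, for every `F` and every `X ⪰ 0`,
`(A + B F)ᵀ X̃ (A + B F) + Cᵀ C + Fᵀ F = D(X) + (F - G)ᵀ (I + Bᵀ X̃ B) (F - G)`,
where `G` is the minimizing feedback. Hence `D` is monotone and concave on the positive
semidefinite cone, and its iterates from `0` increase. A stabilizing feedback has finite cost, which
bounds the iterates, so they converge to a fixed point `X`.

Stability is handled through Lyapunov inequalities: `ρ(S) < 1` holds for a Stein operator `S` iff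
some `P ⪰ I` satisfies `S(P) ⪯ q P` with `q < 1`, or equivalently the same with the adjoint of `S`
(`SDARE.exists_lyapunov`, `SDARE.opSpectralRadius_lt_one_of_lyapunov`). The link with the complex
spectrum is Gelfand's formula for the matrix of the complexification. If `P` is a Lyapunov matrix
for the output injection given by detectability, then `P + c X` is one for the closed loop of any
solution `X ⪰ 0`, which is therefore stabilizing
(`SDARE.opSpectralRadius_closedLoop_lt_one`). Uniqueness holds because a stabilizing solution
dominates every other one (`SDARE.le_of_stabilizing`).

Let `T` be the adjoint Stein operator of the closed loop of `X` and `E_t = X - X_t`. The error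
satisfies `E_{t+1} ⪯ (1 + b tr E_t) T(E_t)`. This first makes `tr E_t` summable, and then bounds the
product of the factors, so that `E_t ⪯ κ T^t(X)` (`SDARE.exists_error_le_pow`). If `X⁺` is a
positive definite generalized inverse of `X` commuting with `X`, then `Y = (1 - 1/κ) X⁺` satisfies
`X (1 - Y X)⁻¹ = κ X`, which is the required form of the error bound.

For the existence of the root limit, the error map `E ↦ X - D(X - E)` is order preserving, convex
and fixes `0`. A bound `E_t ⪯ a X` with `a ≤ 1` thus propagates to `E_{t+s} ⪯ a E_s`. As `E_t` lives
on the range of `X`, `a` can be taken proportional to `tr E_t`, so `tr E_t` is submultiplicative up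
to a constant and Fekete's lemma applies (`SDARE.exists_tendsto_error_rpow`).
-/

noncomputable section

namespace SDARE


/-! ### The Loewner order on real matrices -/

section Loewner

open scoped MatrixOrder

variable {a b : Type*}

theorem transpose_eq_of_nonneg {X : Matrix a a ℝ} (h : 0 ≤ X) : Xᵀ = X := by
  rw [Matrix.nonneg_iff_posSemidef] at h
  simpa using h.isHermitian.eq

theorem smul_mono {c : ℝ} (hc : 0 ≤ c) {X Y : Matrix a a ℝ} (h : X ≤ Y) : c • X ≤ c • Y := by
  rw [Matrix.le_iff, ← smul_sub]
  exact (Matrix.le_iff.mp h).smul hc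

theorem smul_nonneg_matrix {c : ℝ} (hc : 0 ≤ c) {X : Matrix a a ℝ} (h : 0 ≤ X) : 0 ≤ c • X := by
  simpa using smul_mono hc h

theorem smul_le_smul_of_nonneg {c d : ℝ} (hc : c ≤ d) {X : Matrix a a ℝ} (h : 0 ≤ X) :
    c • X ≤ d • X := by
  have := smul_nonneg_matrix (sub_nonneg.mpr hc) h
  rwa [sub_smul, sub_nonneg] at this

variable [Fintype a] [Fintype b]

theorem transpose_mul_mul_mono {X Y : Matrix a a ℝ} (h : X ≤ Y) (V : Matrix a b ℝ) :
    Vᵀ * X * V ≤ Vᵀ * Y * V := by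
  rw [Matrix.le_iff] at h ⊢
  have := h.conjTranspose_mul_mul_same V
  rwa [conjTranspose_eq_transpose_of_trivial, Matrix.mul_sub, Matrix.sub_mul] at this

theorem transpose_mul_mul_nonneg {X : Matrix a a ℝ} (h : 0 ≤ X) (V : Matrix a b ℝ) :
    0 ≤ Vᵀ * X * V := by
  simpa using transpose_mul_mul_mono h V

theorem transpose_mul_self_nonneg (V : Matrix a b ℝ) : 0 ≤ Vᵀ * V := by
  rw [Matrix.nonneg_iff_posSemidef]
  simpa using posSemidef_conjTranspose_mul_self V

theorem exists_eq_transpose_mul_self [DecidableEq a] {X : Matrix a a ℝ} (h : 0 ≤ X) :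
    ∃ V : Matrix a a ℝ, X = Vᵀ * V := by
  obtain ⟨V, hV⟩ := CStarAlgebra.nonneg_iff_eq_star_mul_self.mp h
  exact ⟨V, by simpa [star_eq_conjTranspose] using hV⟩

theorem trace_nonneg_of_nonneg {X : Matrix a a ℝ} (h : 0 ≤ X) : 0 ≤ X.trace :=
  (Matrix.nonneg_iff_posSemidef.mp h).trace_nonneg

theorem trace_mono_of_le {X Y : Matrix a a ℝ} (h : X ≤ Y) : X.trace ≤ Y.trace := by
  simpa using trace_nonneg_of_nonneg (sub_nonneg.mpr h)

theorem trace_mul_nonneg [DecidableEq a] {X Y : Matrix a a ℝ} (hX : 0 ≤ X) (hY : 0 ≤ Y) :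
    0 ≤ (X * Y).trace := by
  obtain ⟨V, rfl⟩ := exists_eq_transpose_mul_self hX
  rw [Matrix.mul_assoc, Matrix.trace_mul_comm]
  have := trace_nonneg_of_nonneg (transpose_mul_mul_nonneg hY Vᵀ)
  rwa [transpose_transpose] at this

theorem trace_mul_mono_left [DecidableEq a] {X Y Z : Matrix a a ℝ} (h : X ≤ Y) (hZ : 0 ≤ Z) :
    (X * Z).trace ≤ (Y * Z).trace := by
  simpa [Matrix.sub_mul] using trace_mul_nonneg (sub_nonneg.mpr h) hZ

theorem trace_mul_mono_right [DecidableEq a] {X Y Z : Matrix a a ℝ} (hZ : 0 ≤ Z) (h : X ≤ Y) :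
    (Z * X).trace ≤ (Z * Y).trace := by
  simpa [Matrix.mul_sub] using trace_mul_nonneg hZ (sub_nonneg.mpr h)

theorem le_iff_dotProduct {X Y : Matrix a a ℝ} (hX : Xᵀ = X) (hY : Yᵀ = Y) :
    X ≤ Y ↔ ∀ v : a → ℝ, v ⬝ᵥ X *ᵥ v ≤ v ⬝ᵥ Y *ᵥ v := by
  rw [Matrix.le_iff, posSemidef_iff_dotProduct_mulVec]
  constructor
  · rintro ⟨-, h⟩ v
    simpa [Matrix.sub_mulVec, dotProduct_sub] using h v
  · intro h
    refine ⟨?_, fun v => ?_⟩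
    · simp [IsHermitian, hX, hY]
    · simpa [Matrix.sub_mulVec, dotProduct_sub] using h v

theorem dotProduct_mulVec_mono {X Y : Matrix a a ℝ} (h : X ≤ Y) (v : a → ℝ) :
    v ⬝ᵥ X *ᵥ v ≤ v ⬝ᵥ Y *ᵥ v := by
  have := (posSemidef_iff_dotProduct_mulVec.mp (Matrix.le_iff.mp h)).2 v
  simpa [Matrix.sub_mulVec, dotProduct_sub] using this

theorem transpose_mul_self_le_trace_smul_one [DecidableEq b] (V : Matrix a b ℝ) :
    Vᵀ * V ≤ (Vᵀ * V).trace • (1 : Matrix b b ℝ) := by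
  rw [le_iff_dotProduct (by simp) (by simp)]
  intro v
  have h1 : v ⬝ᵥ (Vᵀ * V) *ᵥ v = ∑ i, (∑ j, V i j * v j) ^ 2 := by
    rw [← Matrix.mulVec_mulVec, Matrix.dotProduct_mulVec, Matrix.vecMul_transpose]
    simp [dotProduct, mulVec, sq]
  have h2 : (Vᵀ * V).trace = ∑ i, ∑ j, V i j ^ 2 := by
    simp only [Matrix.trace, Matrix.diag, Matrix.mul_apply, Matrix.transpose_apply, ← sq]
    exact Finset.sum_comm
  rw [h1, h2, Matrix.smul_mulVec, Matrix.one_mulVec, dotProduct_smul, smul_eq_mul, Finset.sum_mul]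
  refine Finset.sum_le_sum fun i _ => ?_
  refine (Finset.sum_mul_sq_le_sq_mul_sq _ _ _).trans_eq ?_
  simp [dotProduct, sq]

theorem le_trace_smul_one [DecidableEq a] {X : Matrix a a ℝ} (h : 0 ≤ X) :
    X ≤ X.trace • (1 : Matrix a a ℝ) := by
  obtain ⟨V, rfl⟩ := exists_eq_transpose_mul_self h
  exact transpose_mul_self_le_trace_smul_one V

/-- `X² ⪯ tr(X) X`: the square of a small positive semidefinite matrix is of second order. -/
theorem mul_self_le_trace_smul [DecidableEq a] {X : Matrix a a ℝ} (h : 0 ≤ X) :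
    X * X ≤ X.trace • X := by
  obtain ⟨V, rfl⟩ := exists_eq_transpose_mul_self h
  have := transpose_mul_mul_mono (transpose_mul_self_le_trace_smul_one Vᵀ) V
  rw [Matrix.trace_mul_comm] at this
  simpa [Matrix.mul_assoc] using this

theorem nonneg_of_tendsto {X : ℕ → Matrix a a ℝ} {Y : Matrix a a ℝ}
    (h : Tendsto X atTop (𝓝 Y)) (hX : ∀ t, 0 ≤ X t) : 0 ≤ Y := by
  have hs : Yᵀ = Y := by
    refine tendsto_nhds_unique (((continuous_id.matrix_transpose).tendsto Y).comp h) ?_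
    refine h.congr fun t => ?_
    simp [transpose_eq_of_nonneg (hX t)]
  rw [le_iff_dotProduct (by simp) hs]
  intro v
  have hc : Continuous fun Z : Matrix a a ℝ => v ⬝ᵥ Z *ᵥ v := by fun_prop
  refine ge_of_tendsto ((hc.tendsto Y).comp h) (Eventually.of_forall fun t => ?_)
  exact dotProduct_mulVec_mono (hX t) v

/-- A nondecreasing sequence of positive semidefinite matrices with bounded traces converges. -/
theorem exists_tendsto_of_monotone [DecidableEq a] {X : ℕ → Matrix a a ℝ} (hX : ∀ t, 0 ≤ X t)
    (hmono : ∀ t, X t ≤ X (t + 1)) {c : ℝ} (hc : ∀ t, (X t).trace ≤ c) :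
    ∃ Y, Tendsto X atTop (𝓝 Y) := by
  have hq : ∀ v : a → ℝ, ∃ y, Tendsto (fun t => v ⬝ᵥ X t *ᵥ v) atTop (𝓝 y) := by
    intro v
    refine ⟨_, tendsto_atTop_ciSup
      (monotone_nat_of_le_succ fun t => dotProduct_mulVec_mono (hmono t) v) ?_⟩
    refine ⟨c * (v ⬝ᵥ v), ?_⟩
    rintro _ ⟨t, rfl⟩
    have := dotProduct_mulVec_mono (le_trace_smul_one (hX t)) v
    rw [Matrix.smul_mulVec, Matrix.one_mulVec, dotProduct_smul, smul_eq_mul] at this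
    exact this.trans (mul_le_mul_of_nonneg_right (hc t)
      (by simpa using dotProduct_self_star_nonneg v))
  choose q hq using hq
  -- polarization recovers the entries from the quadratic forms
  have hpol : ∀ t i j, X t i j = ((Pi.single i 1 + Pi.single j 1) ⬝ᵥ
      X t *ᵥ (Pi.single i 1 + Pi.single j 1) - Pi.single i 1 ⬝ᵥ X t *ᵥ Pi.single i 1
      - Pi.single j 1 ⬝ᵥ X t *ᵥ Pi.single j 1) / 2 := by
    intro t i j
    have hs : X t j i = X t i j := congrFun (congrFun (transpose_eq_of_nonneg (hX t)) i) j
    simp [Matrix.mulVec_add, add_dotProduct, dotProduct_add]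
    linarith
  refine ⟨Matrix.of fun i j => (q (Pi.single i 1 + Pi.single j 1) - q (Pi.single i 1)
    - q (Pi.single j 1)) / 2, ?_⟩
  refine tendsto_pi_nhds.mpr fun i => tendsto_pi_nhds.mpr fun j => ?_
  simp only [hpol]
  exact (((hq _).sub (hq _)).sub (hq _)).div_const 2

/-- A positive semidefinite matrix has a positive definite generalized inverse commuting with it:
invert the nonzero eigenvalues and replace the zero ones by `1`. -/
theorem exists_posDef_generalized_inverse [DecidableEq a] {X : Matrix a a ℝ} (h : 0 ≤ X) :
    ∃ Y : Matrix a a ℝ, Y.PosDef ∧ Y * X = X * Y ∧ X * Y * X = X := by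
  rw [Matrix.nonneg_iff_posSemidef] at h
  set d := h.isHermitian.eigenvalues with hd
  set U : Matrix a a ℝ := (h.isHermitian.eigenvectorUnitary : Matrix a a ℝ) with hU
  have hUU : star U * U = 1 := Unitary.coe_star_mul_self h.isHermitian.eigenvectorUnitary
  have hUU' : U * star U = 1 := Unitary.coe_mul_star_self h.isHermitian.eigenvectorUnitary
  have hX : X = U * diagonal d * star U := by
    have := h.isHermitian.spectral_theorem
    simpa [Unitary.conjStarAlgAut_apply, Function.comp_def] using this
  set e : a → ℝ := fun i => if d i = 0 then 1 else (d i)⁻¹ with he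
  have hconj : ∀ f g : a → ℝ, (U * diagonal f * star U) * (U * diagonal g * star U)
      = U * diagonal (fun i => f i * g i) * star U := by
    intro f g
    calc _ = U * diagonal f * (star U * U) * diagonal g * star U := by
          simp only [Matrix.mul_assoc]
      _ = _ := by rw [hUU, Matrix.mul_one, Matrix.mul_assoc U, diagonal_mul_diagonal]
  refine ⟨U * diagonal e * star U, ?_, ?_, ?_⟩
  · have hpos : (diagonal e).PosDef := by
      refine PosDef.diagonal fun i => ?_
      simp only [he]
      split_ifs with h0
      · exact one_pos
      · exact inv_pos.mpr (lt_of_le_of_ne (h.eigenvalues_nonneg i) (Ne.symm h0))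
    have hu : IsUnit U := ⟨⟨U, star U, hUU', hUU⟩, rfl⟩
    exact (Matrix.IsUnit.posDef_star_right_conjugate_iff hu).mpr hpos
  · rw [hX, hconj, hconj]
    simp only [mul_comm]
  · rw [hX, hconj, hconj]
    congr 3
    ext i
    simp only [he]
    split_ifs with h0 <;> simp [h0]

/-- If `0 ≤ E ≤ X` then `E` lives on the range of `X`, so `E` is bounded by a multiple of `X`
which is proportional to the size of `E`. -/
theorem exists_le_trace_smul [DecidableEq a] {X : Matrix a a ℝ} (hX : 0 ≤ X) :
    ∃ k : ℝ, 0 < k ∧ ∀ E, 0 ≤ E → E ≤ X → E ≤ (k * E.trace) • X := by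
  obtain ⟨Y, hY, hcomm, hXYX⟩ := exists_posDef_generalized_inverse hX
  have hYs : Yᵀ = Y := by simpa using hY.isHermitian.eq
  have hXs := transpose_eq_of_nonneg hX
  have hYY : 0 ≤ (Y * Y).trace := by
    have := trace_nonneg_of_nonneg (transpose_mul_self_nonneg Y)
    rwa [hYs] at this
  refine ⟨(Y * Y).trace * X.trace + 1,
    by have := mul_nonneg hYY (trace_nonneg_of_nonneg hX); linarith, fun E hE hEX => ?_⟩
  have hEs := transpose_eq_of_nonneg hE
  have hker : E * (1 - Y * X) = 0 := by
    obtain ⟨V, hV⟩ := exists_eq_transpose_mul_self hE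
    have h1 : (1 - Y * X)ᵀ * E * (1 - Y * X) ≤ (1 - Y * X)ᵀ * X * (1 - Y * X) :=
      transpose_mul_mul_mono hEX _
    have h2 : (1 - Y * X)ᵀ * X * (1 - Y * X) = 0 := by
      have : X * (1 - Y * X) = 0 := by
        rw [Matrix.mul_sub, ← Matrix.mul_assoc, hXYX]; simp
      rw [Matrix.mul_assoc, this, Matrix.mul_zero]
    have h3 := le_antisymm (h2 ▸ h1) (transpose_mul_mul_nonneg hE _)
    rw [hV] at h3 ⊢
    have h4 : V * (1 - Y * X) = 0 := by
      rw [← conjTranspose_mul_self_eq_zero, conjTranspose_eq_transpose_of_trivial, ← h3]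
      simp only [Matrix.transpose_mul, Matrix.mul_assoc]
    rw [Matrix.mul_assoc, h4, Matrix.mul_zero]
  have hE1 : E = E * (Y * X) := by
    rw [Matrix.mul_sub, Matrix.mul_one, sub_eq_zero] at hker
    exact hker
  have hE2 : E = (Y * X)ᵀ * E * (Y * X) := by
    have : E = (Y * X)ᵀ * E := by
      conv_lhs => rw [← hEs, hE1]
      rw [Matrix.transpose_mul E, hEs]
    rw [← this, ← hE1]
  calc E = (Y * X)ᵀ * E * (Y * X) := hE2
    _ ≤ (Y * X)ᵀ * (E.trace • 1) * (Y * X) := transpose_mul_mul_mono (le_trace_smul_one hE) _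
    _ = E.trace • (Xᵀ * (Yᵀ * Y) * X) := by
        simp only [Matrix.transpose_mul, Matrix.mul_smul, Matrix.smul_mul, Matrix.mul_one,
          Matrix.mul_assoc]
    _ ≤ E.trace • (Xᵀ * ((Yᵀ * Y).trace • 1) * X) :=
        smul_mono (trace_nonneg_of_nonneg hE)
          (transpose_mul_mul_mono (le_trace_smul_one (transpose_mul_self_nonneg Y)) _)
    _ = (E.trace * (Y * Y).trace) • (X * X) := by
        simp only [hXs, hYs, Matrix.mul_smul, Matrix.smul_mul, Matrix.mul_one, smul_smul]
    _ ≤ (E.trace * (Y * Y).trace) • (X.trace • X) :=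
        smul_mono (mul_nonneg (trace_nonneg_of_nonneg hE) hYY) (mul_self_le_trace_smul hX)
    _ ≤ (((Y * Y).trace * X.trace + 1) * E.trace) • X := by
        rw [smul_smul]
        refine smul_le_smul_of_nonneg ?_ hX
        nlinarith [trace_nonneg_of_nonneg hE]

end Loewner


/-! ### Spectral radius and growth of powers -/

section SpectralRadius

open scoped Matrix.Norms.L2Operator

variable {V : Type*} [AddCommGroup V] [Module ℝ V]

theorem baseChange_pow_tmul (T : V →ₗ[ℝ] V) (t : ℕ) (v : V) :
    ((T.baseChange ℂ : Module.End ℂ (ℂ ⊗[ℝ] V)) ^ t) ((1 : ℂ) ⊗ₜ[ℝ] v) =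
      (1 : ℂ) ⊗ₜ[ℝ] ((T ^ t) v) := by
  induction t with
  | zero => simp
  | succ t ih => rw [pow_succ', pow_succ', Module.End.mul_apply, ih]; simp

variable [Module.Finite ℝ V]

theorem opSpectralRadius_eq_matrix (T : V →ₗ[ℝ] V) :
    opSpectralRadius T = spectralRadius ℂ (LinearMap.toMatrixAlgEquiv
      (Algebra.TensorProduct.basis ℂ (Module.finBasis ℝ V)) (T.baseChange ℂ)) := by
  unfold opSpectralRadius spectralRadius
  rw [AlgEquiv.spectrum_eq]

/-- Gelfand's formula: every matrix coefficient of `T ^ t` is `O(c ^ t)` when `ρ(T) < c`. -/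
theorem exists_bound_of_opSpectralRadius_lt {T : V →ₗ[ℝ] V} {c : ℝ}
    (h : opSpectralRadius T < ENNReal.ofReal c) (φ : V →ₗ[ℝ] ℝ) (v : V) :
    ∃ K : ℝ, ∀ t, |φ ((T ^ t) v)| ≤ K * c ^ t := by
  have hc : 0 < c := ENNReal.ofReal_pos.mp (bot_le.trans_lt h)
  rw [opSpectralRadius_eq_matrix] at h
  set e := LinearMap.toMatrixAlgEquiv (Algebra.TensorProduct.basis ℂ (Module.finBasis ℝ V)) with he
  set M := e (T.baseChange ℂ) with hM
  have : CompleteSpace (Matrix (Fin (Module.finrank ℝ V)) (Fin (Module.finrank ℝ V)) ℂ) :=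
    FiniteDimensional.complete ℂ _
  have hG := spectrum.pow_norm_pow_one_div_tendsto_nhds_spectralRadius M
  have hev : ∀ᶠ t : ℕ in atTop, ‖M ^ t‖ ≤ c ^ t := by
    filter_upwards [hG.eventually (gt_mem_nhds h), eventually_gt_atTop 0] with t ht ht0
    have h1 : ‖M ^ t‖ ^ (1 / t : ℝ) < c := (ENNReal.ofReal_lt_ofReal_iff hc).mp ht
    have h2 := pow_le_pow_left₀ (by positivity) h1.le t
    rwa [one_div, Real.rpow_inv_natCast_pow (norm_nonneg _) ht0.ne'] at h2
  obtain ⟨N, hN⟩ := eventually_atTop.mp hev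
  -- the finitely many remaining powers only affect the constant
  have hb : ∃ K₀ : ℝ, ∀ t, ‖M ^ t‖ ≤ K₀ * c ^ t := by
    refine ⟨1 + ∑ s ∈ Finset.range N, ‖M ^ s‖ / c ^ s, fun t => ?_⟩
    have hnn : ∀ s ∈ Finset.range N, 0 ≤ ‖M ^ s‖ / c ^ s := fun s _ => by positivity
    have hct : 0 < c ^ t := by positivity
    rcases le_or_gt N t with hNt | hNt
    · have := Finset.sum_nonneg hnn
      nlinarith [hN t hNt]
    · have := Finset.single_le_sum hnn (Finset.mem_range.mpr hNt)
      rw [← div_le_iff₀ hct]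
      linarith
  obtain ⟨K₀, hK₀⟩ := hb
  -- `φ (T ^ t v)` is a linear functional of the matrix `M ^ t`
  let Ψ : Matrix (Fin (Module.finrank ℝ V)) (Fin (Module.finrank ℝ V)) ℂ →ₗ[ℂ] ℂ :=
    (TensorProduct.AlgebraTensorModule.rid ℝ ℂ ℂ).toLinearMap ∘ₗ φ.baseChange ℂ ∘ₗ
      (LinearMap.applyₗ ((1 : ℂ) ⊗ₜ[ℝ] v)) ∘ₗ e.symm.toLinearMap
  have hΨ : ∀ t, Ψ (M ^ t) = ((φ ((T ^ t) v) : ℝ) : ℂ) := by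
    intro t
    have : e.symm (M ^ t) = (T.baseChange ℂ : Module.End ℂ (ℂ ⊗[ℝ] V)) ^ t := by
      rw [hM, ← map_pow, AlgEquiv.symm_apply_apply]
    simp only [Ψ, LinearMap.comp_apply, AlgEquiv.toLinearMap_apply, this,
      LinearMap.applyₗ_apply_apply, baseChange_pow_tmul]
    simp
  refine ⟨‖LinearMap.toContinuousLinearMap Ψ‖ * K₀, fun t => ?_⟩
  have h1 := (LinearMap.toContinuousLinearMap Ψ).le_opNorm (M ^ t)
  rw [LinearMap.coe_toContinuousLinearMap', hΨ, Complex.norm_real, Real.norm_eq_abs] at h1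
  refine h1.trans ?_
  rw [mul_assoc]
  exact mul_le_mul_of_nonneg_left (hK₀ t) (norm_nonneg _)

theorem opSpectralRadius_lt_one_of_tendsto {T : V →ₗ[ℝ] V}
    (h : ∀ (φ : V →ₗ[ℝ] ℝ) (v : V), Tendsto (fun t => φ ((T ^ t) v)) atTop (𝓝 0)) :
    opSpectralRadius T < 1 := by
  rw [opSpectralRadius_eq_matrix]
  set b := Module.finBasis ℝ V with hb
  set e := LinearMap.toMatrixAlgEquiv (Algebra.TensorProduct.basis ℂ b) with he
  set M := e (T.baseChange ℂ) with hM
  have : CompleteSpace (Matrix (Fin (Module.finrank ℝ V)) (Fin (Module.finrank ℝ V)) ℂ) :=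
    FiniteDimensional.complete ℂ _
  have hentry : ∀ t i j, (M ^ t) i j = ((b.coord i ((T ^ t) (b j)) : ℝ) : ℂ) := by
    intro t i j
    rw [hM, ← map_pow, he, LinearMap.toMatrixAlgEquiv_apply, Algebra.TensorProduct.basis_apply,
      baseChange_pow_tmul]
    simp
  have hlim : Tendsto (fun t => M ^ t) atTop (𝓝 0) := by
    refine tendsto_pi_nhds.mpr fun i => tendsto_pi_nhds.mpr fun j => ?_
    simp only [hentry]
    have := (Complex.continuous_ofReal.tendsto 0).comp (h (b.coord i) (b j))
    simpa [Function.comp_def] using this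
  have hlim' : Tendsto (fun t => ‖M ^ t‖ * ‖(1 : Matrix (Fin (Module.finrank ℝ V))
      (Fin (Module.finrank ℝ V)) ℂ)‖) atTop (𝓝 0) := by
    simpa using (tendsto_zero_iff_norm_tendsto_zero.mp hlim).mul_const _
  obtain ⟨t, ht1, ht⟩ := ((hlim'.eventually (gt_mem_nhds one_pos)).and
    (eventually_gt_atTop 0)).exists
  obtain ⟨s, rfl⟩ : ∃ s, t = s + 1 := ⟨t - 1, by omega⟩
  refine (spectrum.spectralRadius_le_pow_nnnorm_pow_one_div ℂ M s).trans_lt ?_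
  rw [← ENNReal.mul_rpow_of_nonneg _ _ (by positivity)]
  refine ENNReal.rpow_lt_one ?_ (by positivity)
  rw [← ENNReal.coe_mul]
  exact_mod_cast ht1

end SpectralRadius


/-! ### Lyapunov inequalities for Stein operators -/

section Stein

open scoped MatrixOrder

variable {n r : ℕ}

theorem one_nonneg_matrix : (0 : Matrix (Fin n) (Fin n) ℝ) ≤ 1 := by simp

theorem steinOp_apply (M : Fin r → Matrix (Fin n) (Fin n) ℝ) (Z : Matrix (Fin n) (Fin n) ℝ) :
    steinOp M Z = ∑ i, M i * Z * (M i)ᵀ := rfl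

theorem steinOpAdjoint_apply (M : Fin r → Matrix (Fin n) (Fin n) ℝ)
    (Z : Matrix (Fin n) (Fin n) ℝ) : steinOpAdjoint M Z = ∑ i, (M i)ᵀ * Z * M i := by
  simp [steinOpAdjoint, steinOp_apply]

theorem steinOp_nonneg (M : Fin r → Matrix (Fin n) (Fin n) ℝ) {Z : Matrix (Fin n) (Fin n) ℝ}
    (h : 0 ≤ Z) : 0 ≤ steinOp M Z := by
  rw [steinOp_apply]
  refine Finset.sum_nonneg fun i _ => ?_
  simpa using transpose_mul_mul_nonneg h (M i)ᵀ

theorem steinOp_mono (M : Fin r → Matrix (Fin n) (Fin n) ℝ) {Y Z : Matrix (Fin n) (Fin n) ℝ}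
    (h : Y ≤ Z) : steinOp M Y ≤ steinOp M Z := by
  rw [← sub_nonneg, ← map_sub]
  exact steinOp_nonneg M (sub_nonneg.mpr h)

theorem steinOp_pow_nonneg (M : Fin r → Matrix (Fin n) (Fin n) ℝ) {Z : Matrix (Fin n) (Fin n) ℝ}
    (h : 0 ≤ Z) (t : ℕ) : 0 ≤ (steinOp M ^ t) Z := by
  induction t with
  | zero => simpa using h
  | succ t ih => rw [pow_succ', Module.End.mul_apply]; exact steinOp_nonneg M ih

/-- Powers of a Stein operator are Stein operators, of the products of the given matrices. -/
theorem exists_steinOp_pow_eq (M : Fin r → Matrix (Fin n) (Fin n) ℝ) (t : ℕ) :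
    ∃ (k : ℕ) (M' : Fin k → Matrix (Fin n) (Fin n) ℝ), steinOp M ^ t = steinOp M' := by
  induction t with
  | zero =>
    refine ⟨1, fun _ => 1, ?_⟩
    ext1 Z
    simp [steinOp_apply]
  | succ t ih =>
    obtain ⟨k, M', h⟩ := ih
    refine ⟨r * k, fun p => M (finProdFinEquiv.symm p).1 * M' (finProdFinEquiv.symm p).2, ?_⟩
    refine LinearMap.ext fun Z => ?_
    rw [pow_succ', h, Module.End.mul_apply, steinOp_apply, steinOp_apply, steinOp_apply,
      Equiv.sum_comp finProdFinEquiv.symm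
        (fun p : Fin r × Fin k => M p.1 * M' p.2 * Z * (M p.1 * M' p.2)ᵀ), Fintype.sum_prod_type]
    simp only [Matrix.mul_sum, Matrix.sum_mul, Matrix.transpose_mul, Matrix.mul_assoc]

theorem trace_mul_steinOp (M : Fin r → Matrix (Fin n) (Fin n) ℝ)
    (P Z : Matrix (Fin n) (Fin n) ℝ) :
    (P * steinOp M Z).trace = (steinOpAdjoint M P * Z).trace := by
  simp only [steinOp_apply, steinOpAdjoint_apply, Matrix.mul_sum, Matrix.sum_mul,
    Matrix.trace_sum]
  refine Finset.sum_congr rfl fun i _ => ?_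
  rw [← Matrix.mul_assoc, Matrix.trace_mul_comm]
  simp only [Matrix.mul_assoc]

theorem steinOpAdjoint_transpose (M : Fin r → Matrix (Fin n) (Fin n) ℝ) :
    steinOpAdjoint (fun i => (M i)ᵀ) = steinOp M := by
  simp [steinOpAdjoint]

theorem trace_mul_steinOpAdjoint (M : Fin r → Matrix (Fin n) (Fin n) ℝ)
    (P Z : Matrix (Fin n) (Fin n) ℝ) :
    (P * steinOpAdjoint M Z).trace = (steinOp M P * Z).trace := by
  rw [steinOpAdjoint, trace_mul_steinOp, steinOpAdjoint_transpose]

theorem trace_mul_steinOpAdjoint_pow (M : Fin r → Matrix (Fin n) (Fin n) ℝ)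
    (P Z : Matrix (Fin n) (Fin n) ℝ) (t : ℕ) :
    (P * (steinOpAdjoint M ^ t) Z).trace = ((steinOp M ^ t) P * Z).trace := by
  induction t generalizing P with
  | zero => simp
  | succ t ih =>
    rw [pow_succ', Module.End.mul_apply, trace_mul_steinOpAdjoint, ih, pow_succ,
      Module.End.mul_apply]

theorem trace_mul_steinOp_pow_le {M : Fin r → Matrix (Fin n) (Fin n) ℝ}
    {P : Matrix (Fin n) (Fin n) ℝ} {q : ℝ} (hq : 0 ≤ q) (hP : steinOpAdjoint M P ≤ q • P)
    {Z : Matrix (Fin n) (Fin n) ℝ} (hZ : 0 ≤ Z) (t : ℕ) :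
    (P * (steinOp M ^ t) Z).trace ≤ q ^ t * (P * Z).trace := by
  induction t with
  | zero => simp
  | succ t ih =>
    rw [pow_succ', Module.End.mul_apply, trace_mul_steinOp]
    refine (trace_mul_mono_left hP (steinOp_pow_nonneg M hZ t)).trans ?_
    rw [Matrix.smul_mul, Matrix.trace_smul, smul_eq_mul, pow_succ', mul_assoc]
    exact mul_le_mul_of_nonneg_left ih hq

theorem trace_le_trace_mul {P Z : Matrix (Fin n) (Fin n) ℝ} (hP : 1 ≤ P) (hZ : 0 ≤ Z) :
    Z.trace ≤ (P * Z).trace := by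
  simpa using trace_mul_mono_left hP hZ

theorem trace_mul_le_trace_mul_trace {P Z : Matrix (Fin n) (Fin n) ℝ} (hP : 0 ≤ P) (hZ : 0 ≤ Z) :
    (P * Z).trace ≤ P.trace * Z.trace := by
  simpa using trace_mul_mono_left (le_trace_smul_one hP) hZ

/-- A strict inequality `1 ≤ P`, `S(P) ≤ P - c` upgrades to a contraction `S(P) ≤ q P`. -/
theorem exists_contraction_of_le_sub {P SP : Matrix (Fin n) (Fin n) ℝ} (hP : 0 ≤ P) {c : ℝ}
    (hc : 0 < c) (hSP : SP ≤ P - c • (1 : Matrix (Fin n) (Fin n) ℝ)) :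
    ∃ q : ℝ, 0 ≤ q ∧ q < 1 ∧ SP ≤ q • P := by
  have hτ : 0 < P.trace + c := add_pos_of_nonneg_of_pos (trace_nonneg_of_nonneg hP) hc
  have h1 : (c / (P.trace + c)) • P ≤ c • (1 : Matrix (Fin n) (Fin n) ℝ) := by
    calc (c / (P.trace + c)) • P
        ≤ (c / (P.trace + c)) • ((P.trace + c) • (1 : Matrix (Fin n) (Fin n) ℝ)) := by
          refine smul_mono (by positivity) ((le_trace_smul_one hP).trans ?_)
          refine smul_le_smul_of_nonneg (by linarith) ?_
          exact one_nonneg_matrix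
      _ = c • (1 : Matrix (Fin n) (Fin n) ℝ) := by
          rw [smul_smul, div_mul_cancel₀ _ hτ.ne']
  have h2 : 0 < c / (P.trace + c) := by positivity
  have h3 : c / (P.trace + c) ≤ 1 := by
    rw [div_le_one hτ]; linarith [trace_nonneg_of_nonneg hP]
  refine ⟨1 - c / (P.trace + c), by linarith, by linarith, hSP.trans ?_⟩
  rw [sub_smul, one_smul]
  exact sub_le_sub_left h1 P

theorem exists_trace_steinOp_pow_le {M : Fin r → Matrix (Fin n) (Fin n) ℝ} {c : ℝ}
    (h : opSpectralRadius (steinOp M) < ENNReal.ofReal c) :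
    ∃ K : ℝ, ∀ t, ((steinOp M ^ t) 1).trace ≤ K * c ^ t := by
  obtain ⟨K, hK⟩ := exists_bound_of_opSpectralRadius_lt h
    (Matrix.traceLinearMap (Fin n) ℝ ℝ) (1 : Matrix (Fin n) (Fin n) ℝ)
  exact ⟨K, fun t => (le_abs_self _).trans (hK t)⟩

/-- A stable Stein operator has a Lyapunov matrix, namely a partial sum of its Neumann series
applied to `I`, long enough for the remainder to be at most `I / 2`. -/
theorem exists_lyapunov {M : Fin r → Matrix (Fin n) (Fin n) ℝ}
    (h : opSpectralRadius (steinOp M) < 1) :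
    ∃ (P : Matrix (Fin n) (Fin n) ℝ) (q : ℝ), 1 ≤ P ∧ 0 ≤ q ∧ q < 1 ∧ steinOp M P ≤ q • P := by
  obtain ⟨c, hc0, hc, hc1⟩ := ENNReal.lt_iff_exists_real_btwn.mp h
  rw [← ENNReal.ofReal_one, ENNReal.ofReal_lt_ofReal_iff one_pos] at hc1
  obtain ⟨K, hK⟩ := exists_trace_steinOp_pow_le hc
  have hlim : Tendsto (fun t : ℕ => K * c ^ t) atTop (𝓝 0) := by
    simpa using (tendsto_pow_atTop_nhds_zero_of_lt_one hc0 hc1).const_mul K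
  obtain ⟨t, ht1, ht0⟩ := ((hlim.eventually (gt_mem_nhds (half_pos one_pos))).and
    (eventually_gt_atTop 0)).exists
  set P := ∑ s ∈ Finset.range t, (steinOp M ^ s) (1 : Matrix (Fin n) (Fin n) ℝ) with hPdef
  have hP1 : 1 ≤ P := by
    have := Finset.single_le_sum (f := fun s => (steinOp M ^ s) (1 : Matrix (Fin n) (Fin n) ℝ))
      (fun s _ => steinOp_pow_nonneg M one_nonneg_matrix s) (Finset.mem_range.mpr ht0)
    simpa using this
  -- telescoping
  have hSP : steinOp M P = P - 1 + (steinOp M ^ t) 1 := by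
    have h1 : steinOp M P =
        ∑ s ∈ Finset.range t, (steinOp M ^ (s + 1)) (1 : Matrix (Fin n) (Fin n) ℝ) := by
      rw [hPdef, map_sum]
      refine Finset.sum_congr rfl fun s _ => ?_
      rw [pow_succ', Module.End.mul_apply]
    have h2 := Finset.sum_range_succ' (fun s => (steinOp M ^ s) (1 : Matrix (Fin n) (Fin n) ℝ)) t
    rw [Finset.sum_range_succ, ← h1, ← hPdef] at h2
    simp only [pow_zero, Module.End.one_apply] at h2
    rw [sub_add_eq_add_sub, h2, add_sub_cancel_right]
  have hle : steinOp M P ≤ P - (1 / 2 : ℝ) • (1 : Matrix (Fin n) (Fin n) ℝ) := by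
    have h1 : (steinOp M ^ t) (1 : Matrix (Fin n) (Fin n) ℝ) ≤ (1 / 2 : ℝ) • 1 :=
      (le_trace_smul_one (steinOp_pow_nonneg M one_nonneg_matrix t)).trans
        (smul_le_smul_of_nonneg ((hK t).trans (by linarith)) one_nonneg_matrix)
    have h2 : (1 : Matrix (Fin n) (Fin n) ℝ) = (1 / 2 : ℝ) • 1 + (1 / 2 : ℝ) • 1 := by
      rw [← add_smul]; norm_num
    rw [hSP]
    calc P - 1 + (steinOp M ^ t) 1 ≤ P - 1 + (1 / 2 : ℝ) • 1 := add_le_add le_rfl h1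
      _ = P - (1 / 2 : ℝ) • (1 : Matrix (Fin n) (Fin n) ℝ) := by
        nth_rw 1 [h2]; abel
  obtain ⟨q, hq0, hq1, hq⟩ := exists_contraction_of_le_sub
    (one_nonneg_matrix.trans hP1) (half_pos one_pos) hle
  exact ⟨P, q, hP1, hq0, hq1, hq⟩

theorem two_mul_trace_le (X Y : Matrix (Fin n) (Fin n) ℝ) :
    2 * (Xᵀ * Y).trace ≤ (Xᵀ * X).trace + (Yᵀ * Y).trace := by
  have h := trace_nonneg_of_nonneg (transpose_mul_self_nonneg (X - Y))
  have h2 : (Yᵀ * X).trace = (Xᵀ * Y).trace := by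
    rw [← Matrix.trace_transpose, Matrix.transpose_mul, Matrix.transpose_transpose]
  simp only [Matrix.transpose_sub, Matrix.sub_mul, Matrix.mul_sub, Matrix.trace_sub, h2] at h
  linarith

/-- The Cauchy–Schwarz inequality for the pairing of a Stein operator, in additive form. -/
theorem two_mul_trace_steinOp_le (M : Fin r → Matrix (Fin n) (Fin n) ℝ)
    (W Z : Matrix (Fin n) (Fin n) ℝ) :
    2 * (Wᵀ * steinOp M Z).trace ≤
      ((Wᵀ * W) * steinOp M 1).trace + (steinOp M (Z * Zᵀ)).trace := by
  simp only [steinOp_apply, Matrix.trace_sum, Finset.mul_sum, ← Finset.sum_add_distrib]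
  refine Finset.sum_le_sum fun i _ => ?_
  have h := two_mul_trace_le (W * M i) (M i * Z)
  have h1 : ((W * M i)ᵀ * (M i * Z)).trace = (Wᵀ * (M i * Z * (M i)ᵀ)).trace := by
    rw [Matrix.transpose_mul, Matrix.mul_assoc, Matrix.trace_mul_comm]
    simp only [Matrix.mul_assoc]
  have h2 : ((W * M i)ᵀ * (W * M i)).trace = (Wᵀ * W * (M i * 1 * (M i)ᵀ)).trace := by
    rw [Matrix.transpose_mul, Matrix.mul_assoc, Matrix.trace_mul_comm]
    simp only [Matrix.mul_assoc, Matrix.mul_one]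
  have h3 : ((M i * Z)ᵀ * (M i * Z)).trace = (M i * (Z * Zᵀ) * (M i)ᵀ).trace := by
    rw [Matrix.trace_mul_comm, Matrix.transpose_mul]
    simp only [Matrix.mul_assoc]
  linarith

/-- A Lyapunov matrix for the adjoint makes a Stein operator stable. The trace of `P` against the
orbit decays for positive semidefinite starting points; other starting points, which need not be
symmetric, are reached by the Cauchy–Schwarz inequality. -/
theorem opSpectralRadius_lt_one_of_lyapunov {M : Fin r → Matrix (Fin n) (Fin n) ℝ}
    {P : Matrix (Fin n) (Fin n) ℝ} {q : ℝ} (hP1 : 1 ≤ P) (hq0 : 0 ≤ q) (hq1 : q < 1)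
    (hP : steinOpAdjoint M P ≤ q • P) : opSpectralRadius (steinOp M) < 1 := by
  have hdecay : ∀ Z : Matrix (Fin n) (Fin n) ℝ, 0 ≤ Z →
      Tendsto (fun t => ((steinOp M ^ t) Z).trace) atTop (𝓝 0) := by
    intro Z hZ
    have hlim : Tendsto (fun t : ℕ => q ^ t * (P * Z).trace) atTop (𝓝 0) := by
      simpa using (tendsto_pow_atTop_nhds_zero_of_lt_one hq0 hq1).mul_const (P * Z).trace
    refine squeeze_zero (fun t => trace_nonneg_of_nonneg (steinOp_pow_nonneg M hZ t))
      (fun t => ?_) hlim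
    exact (trace_le_trace_mul hP1 (steinOp_pow_nonneg M hZ t)).trans
      (trace_mul_steinOp_pow_le hq0 hP hZ t)
  have hpair : ∀ W Z : Matrix (Fin n) (Fin n) ℝ,
      Tendsto (fun t => (Wᵀ * (steinOp M ^ t) Z).trace) atTop (𝓝 0) := by
    intro W Z
    have hZZ : 0 ≤ Z * Zᵀ := by simpa using transpose_mul_self_nonneg Zᵀ
    have hlim : Tendsto (fun t => ((Wᵀ * W).trace * ((steinOp M ^ t) 1).trace +
        ((steinOp M ^ t) (Z * Zᵀ)).trace) / 2) atTop (𝓝 0) := by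
      simpa using (((hdecay 1 one_nonneg_matrix).const_mul (Wᵀ * W).trace).add
        (hdecay _ hZZ)).div_const 2
    refine squeeze_zero_norm (fun t => ?_) hlim
    obtain ⟨k, M', hM'⟩ := exists_steinOp_pow_eq M t
    have h0 := trace_mul_le_trace_mul_trace (transpose_mul_self_nonneg W)
      (steinOp_nonneg M' one_nonneg_matrix)
    have h1 := two_mul_trace_steinOp_le M' W Z
    have h2 := two_mul_trace_steinOp_le M' (-W) Z
    simp only [Matrix.transpose_neg, Matrix.neg_mul, Matrix.mul_neg, neg_neg,
      Matrix.trace_neg] at h2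
    rw [hM', Real.norm_eq_abs, abs_le]
    constructor <;> linarith
  refine opSpectralRadius_lt_one_of_tendsto fun φ Z => ?_
  have hmat : Tendsto (fun t => (steinOp M ^ t) Z) atTop (𝓝 0) := by
    refine tendsto_pi_nhds.mpr fun i => tendsto_pi_nhds.mpr fun j => ?_
    have := hpair (Matrix.single i j 1) Z
    simpa [Matrix.transpose_single, Matrix.trace_single_mul] using this
  have hφ : Continuous φ := LinearMap.continuous_of_finiteDimensional φ
  have := (hφ.tendsto 0).comp hmat
  simpa [Function.comp_def] using this

end Stein


/-! ### The Riccati operator as a minimum over feedbacks -/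

section Riccati

open scoped MatrixOrder

variable {n m l r : ℕ}

/-- The blocks of a matrix whose rows are indexed by pairs; this inverts `permStack`. -/
def blocks {k : ℕ} (N : Matrix (Fin n × Fin r) (Fin k) ℝ) : Fin r → Matrix (Fin n) (Fin k) ℝ :=
  fun i => Matrix.of fun a b => N (a, i) b

theorem permStack_blocks {k : ℕ} (N : Matrix (Fin n × Fin r) (Fin k) ℝ) :
    permStack (blocks N) = N := rfl

/-- `X ⊗ I_r`, the block-diagonal amplification of `X`. -/
def lift (r : ℕ) (X : Matrix (Fin n) (Fin n) ℝ) : Matrix (Fin n × Fin r) (Fin n × Fin r) ℝ :=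
  X ⊗ₖ (1 : Matrix (Fin r) (Fin r) ℝ)

theorem lift_add (X Y : Matrix (Fin n) (Fin n) ℝ) : lift r (X + Y) = lift r X + lift r Y :=
  Matrix.add_kronecker X Y 1

theorem lift_smul (c : ℝ) (X : Matrix (Fin n) (Fin n) ℝ) : lift r (c • X) = c • lift r X :=
  Matrix.smul_kronecker c X 1

theorem lift_sub (X Y : Matrix (Fin n) (Fin n) ℝ) : lift r (X - Y) = lift r X - lift r Y := by
  rw [eq_sub_iff_add_eq, ← lift_add, sub_add_cancel]

theorem lift_mul (X Y : Matrix (Fin n) (Fin n) ℝ) : lift r (X * Y) = lift r X * lift r Y := by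
  rw [lift, lift, lift, ← Matrix.mul_kronecker_mul, Matrix.mul_one]

theorem lift_nonneg {X : Matrix (Fin n) (Fin n) ℝ} (h : 0 ≤ X) : 0 ≤ lift r X := by
  rw [Matrix.nonneg_iff_posSemidef] at h ⊢
  exact h.kronecker PosSemidef.one

theorem lift_mono {X Y : Matrix (Fin n) (Fin n) ℝ} (h : X ≤ Y) : lift r X ≤ lift r Y := by
  rw [← sub_nonneg, ← lift_sub]
  exact lift_nonneg (sub_nonneg.mpr h)

theorem continuous_lift : Continuous (lift r : Matrix (Fin n) (Fin n) ℝ → _) := by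
  refine continuous_matrix fun p q => ?_
  exact (continuous_id.matrix_elem p.1 q.1).mul continuous_const

theorem transpose_permStack_mul {k k' : ℕ} (M : Fin r → Matrix (Fin n) (Fin k) ℝ)
    (M' : Fin r → Matrix (Fin n) (Fin k') ℝ) (X : Matrix (Fin n) (Fin n) ℝ) :
    (permStack M)ᵀ * lift r X * permStack M' = ∑ i, (M i)ᵀ * X * M' i := by
  ext a b
  simp only [Matrix.mul_apply, Matrix.sum_apply, Fintype.sum_prod_type, permStack, lift,
    Matrix.kronecker_apply, Matrix.one_apply, Matrix.transpose_apply, Matrix.of_apply, mul_ite,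
    mul_one, mul_zero, Finset.sum_ite_eq', Finset.mem_univ, if_true]
  exact Finset.sum_comm

theorem steinOpAdjoint_blocks (N : Matrix (Fin n × Fin r) (Fin n) ℝ)
    (X : Matrix (Fin n) (Fin n) ℝ) : steinOpAdjoint (blocks N) X = Nᵀ * lift r X * N := by
  rw [steinOpAdjoint_apply, ← transpose_permStack_mul, permStack_blocks]

/-- The weight `I + Bᵀ (X ⊗ I_r) B` of the control in one step of the dynamic programming
recursion with cost-to-go `X`. -/
def weight (B : Matrix (Fin n × Fin r) (Fin m) ℝ) (X : Matrix (Fin n) (Fin n) ℝ) :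
    Matrix (Fin m) (Fin m) ℝ :=
  1 + Bᵀ * lift r X * B

/-- The minimizing feedback for the cost-to-go `X`. -/
def gain (A : Matrix (Fin n × Fin r) (Fin n) ℝ) (B : Matrix (Fin n × Fin r) (Fin m) ℝ)
    (X : Matrix (Fin n) (Fin n) ℝ) : Matrix (Fin m) (Fin n) ℝ :=
  -((weight B X)⁻¹ * (Bᵀ * lift r X * A))

/-- The one-step cost of the feedback `F` with cost-to-go `X`. -/
def cost (A : Matrix (Fin n × Fin r) (Fin n) ℝ) (B : Matrix (Fin n × Fin r) (Fin m) ℝ)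
    (C : Matrix (Fin l) (Fin n) ℝ) (F : Matrix (Fin m) (Fin n) ℝ)
    (X : Matrix (Fin n) (Fin n) ℝ) : Matrix (Fin n) (Fin n) ℝ :=
  steinOpAdjoint (blocks (A + B * F)) X + (Cᵀ * C + Fᵀ * F)

variable (A : Matrix (Fin n × Fin r) (Fin n) ℝ) (B : Matrix (Fin n × Fin r) (Fin m) ℝ)
  (C : Matrix (Fin l) (Fin n) ℝ)

theorem weight_posDef {X : Matrix (Fin n) (Fin n) ℝ} (h : 0 ≤ X) : (weight B X).PosDef :=
  PosDef.one.add_posSemidef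
    (Matrix.nonneg_iff_posSemidef.mp (transpose_mul_mul_nonneg (lift_nonneg h) B))

theorem isUnit_det_weight {X : Matrix (Fin n) (Fin n) ℝ} (h : 0 ≤ X) :
    IsUnit (weight B X).det :=
  (Matrix.isUnit_iff_isUnit_det _).mp (weight_posDef B h).isUnit

theorem weight_transpose {X : Matrix (Fin n) (Fin n) ℝ} (h : 0 ≤ X) :
    (weight B X)ᵀ = weight B X := by
  simpa using (weight_posDef B h).isHermitian.eq

/-- The Woodbury identity for the inverse in the Riccati operator. -/
theorem one_add_ltimes_mul {X : Matrix (Fin n) (Fin n) ℝ} (h : 0 ≤ X) :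
    (1 + ltimes (B * Bᵀ) X) * (1 - B * (weight B X)⁻¹ * (Bᵀ * lift r X)) = 1 := by
  have hW : (1 + Bᵀ * lift r X * B) * (weight B X)⁻¹ = 1 :=
    Matrix.mul_nonsing_inv _ (isUnit_det_weight B h)
  have h1 : ltimes (B * Bᵀ) X = B * (Bᵀ * lift r X) := by
    rw [ltimes, ← lift, Matrix.mul_assoc]
  calc (1 + ltimes (B * Bᵀ) X) * (1 - B * (weight B X)⁻¹ * (Bᵀ * lift r X))
      = 1 + B * (Bᵀ * lift r X)
        - B * ((1 + Bᵀ * lift r X * B) * (weight B X)⁻¹) * (Bᵀ * lift r X) := by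
        rw [h1]
        simp only [Matrix.add_mul, Matrix.mul_sub, Matrix.mul_add, Matrix.mul_one, Matrix.one_mul,
          Matrix.mul_assoc]
    _ = 1 := by rw [hW, Matrix.mul_one, add_sub_cancel_right]

theorem isUnit_one_add_ltimes {X : Matrix (Fin n) (Fin n) ℝ} (h : 0 ≤ X) :
    IsUnit (1 + ltimes (B * Bᵀ) X) :=
  (Matrix.isUnit_iff_isUnit_det _).mpr
    (Matrix.isUnit_det_of_right_inverse (one_add_ltimes_mul B h))

theorem riccatiOp_eq {X : Matrix (Fin n) (Fin n) ℝ} (h : 0 ≤ X) :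
    riccatiOp A B C X = Aᵀ * lift r X * A -
      Aᵀ * lift r X * B * (weight B X)⁻¹ * (Bᵀ * lift r X * A) + Cᵀ * C := by
  rw [riccatiOp, Matrix.inv_eq_right_inv (one_add_ltimes_mul B h), ltimes, ← lift]
  simp only [Matrix.mul_sub, Matrix.sub_mul, Matrix.mul_one, Matrix.mul_assoc]

/-- Completion of the square in the feedback. -/
theorem cost_eq {X : Matrix (Fin n) (Fin n) ℝ} (h : 0 ≤ X) (F : Matrix (Fin m) (Fin n) ℝ) :
    cost A B C F X = riccatiOp A B C X +
      (F - gain A B X)ᵀ * weight B X * (F - gain A B X) := by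
  have hWs := weight_transpose B h
  have hXs : (lift r X)ᵀ = lift r X := transpose_eq_of_nonneg (lift_nonneg h)
  have hW1 : weight B X * (weight B X)⁻¹ = 1 := Matrix.mul_nonsing_inv _ (isUnit_det_weight B h)
  have hW2 : (weight B X)⁻¹ * weight B X = 1 := Matrix.nonsing_inv_mul _ (isUnit_det_weight B h)
  have hsum : weight B X * (F - gain A B X) = weight B X * F + Bᵀ * lift r X * A := by
    rw [gain, sub_neg_eq_add, Matrix.mul_add, ← Matrix.mul_assoc (weight B X) (weight B X)⁻¹, hW1,
      Matrix.one_mul]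
  have hsumT : (F - gain A B X)ᵀ = Fᵀ + Aᵀ * lift r X * B * (weight B X)⁻¹ := by
    rw [gain, sub_neg_eq_add, Matrix.transpose_add, Matrix.transpose_mul,
      Matrix.transpose_nonsing_inv, hWs]
    simp only [Matrix.transpose_mul, hXs, Matrix.transpose_transpose, Matrix.mul_assoc]
  have hcross : Aᵀ * lift r X * B * (weight B X)⁻¹ * (weight B X * F) = Aᵀ * lift r X * B * F := by
    rw [← Matrix.mul_assoc _ (weight B X) F, Matrix.mul_assoc _ (weight B X)⁻¹, hW2,
      Matrix.mul_one]
  rw [Matrix.mul_assoc _ (weight B X), hsum, hsumT, riccatiOp_eq A B C h, cost,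
    steinOpAdjoint_blocks, Matrix.add_mul _ _ (weight B X * F + _), Matrix.mul_add (Fᵀ),
    Matrix.mul_add (Aᵀ * lift r X * B * (weight B X)⁻¹), hcross]
  simp only [weight, Matrix.transpose_add, Matrix.transpose_mul, Matrix.add_mul, Matrix.mul_add,
    Matrix.one_mul, Matrix.mul_assoc]
  abel

theorem riccatiOp_le_cost {X : Matrix (Fin n) (Fin n) ℝ} (h : 0 ≤ X)
    (F : Matrix (Fin m) (Fin n) ℝ) : riccatiOp A B C X ≤ cost A B C F X := by
  rw [cost_eq A B C h]
  exact le_add_of_nonneg_right (transpose_mul_mul_nonneg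
    (Matrix.nonneg_iff_posSemidef.mpr (weight_posDef B h).posSemidef) _)

theorem cost_gain {X : Matrix (Fin n) (Fin n) ℝ} (h : 0 ≤ X) :
    cost A B C (gain A B X) X = riccatiOp A B C X := by
  rw [cost_eq A B C h]; simp

theorem steinOpAdjoint_nonneg (M : Fin r → Matrix (Fin n) (Fin n) ℝ)
    {X : Matrix (Fin n) (Fin n) ℝ} (h : 0 ≤ X) : 0 ≤ steinOpAdjoint M X := steinOp_nonneg _ h

theorem steinOpAdjoint_mono (M : Fin r → Matrix (Fin n) (Fin n) ℝ)
    {X Y : Matrix (Fin n) (Fin n) ℝ} (h : X ≤ Y) : steinOpAdjoint M X ≤ steinOpAdjoint M Y :=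
  steinOp_mono _ h

theorem runningCost_nonneg (F : Matrix (Fin m) (Fin n) ℝ) : 0 ≤ Cᵀ * C + Fᵀ * F :=
  add_nonneg (transpose_mul_self_nonneg C) (transpose_mul_self_nonneg F)

theorem cost_mono (F : Matrix (Fin m) (Fin n) ℝ) {X Y : Matrix (Fin n) (Fin n) ℝ} (h : X ≤ Y) :
    cost A B C F X ≤ cost A B C F Y :=
  add_le_add (steinOpAdjoint_mono _ h) le_rfl

theorem riccatiOp_nonneg {X : Matrix (Fin n) (Fin n) ℝ} (h : 0 ≤ X) :
    0 ≤ riccatiOp A B C X := by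
  rw [← cost_gain A B C h]
  exact add_nonneg (steinOpAdjoint_nonneg _ h) (runningCost_nonneg C _)

theorem riccatiOp_mono {X Y : Matrix (Fin n) (Fin n) ℝ} (hX : 0 ≤ X) (h : X ≤ Y) :
    riccatiOp A B C X ≤ riccatiOp A B C Y := by
  rw [← cost_gain A B C (hX.trans h)]
  exact (riccatiOp_le_cost A B C hX _).trans (cost_mono A B C _ h)

/-- The Riccati operator is a minimum of affine maps, hence concave. -/
theorem riccatiOp_concave {X Y : Matrix (Fin n) (Fin n) ℝ} (hX : 0 ≤ X) (hY : 0 ≤ Y) {s : ℝ}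
    (hs0 : 0 ≤ s) (hs1 : s ≤ 1) :
    (1 - s) • riccatiOp A B C X + s • riccatiOp A B C Y ≤
      riccatiOp A B C ((1 - s) • X + s • Y) := by
  have hs1' : 0 ≤ 1 - s := by linarith
  have hZ : 0 ≤ (1 - s) • X + s • Y :=
    add_nonneg (smul_nonneg_matrix hs1' hX) (smul_nonneg_matrix hs0 hY)
  rw [← cost_gain A B C hZ]
  set F := gain A B ((1 - s) • X + s • Y)
  have haff : cost A B C F ((1 - s) • X + s • Y) =
      (1 - s) • cost A B C F X + s • cost A B C F Y := by
    simp only [cost, map_add, map_smul]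
    module
  rw [haff]
  exact add_le_add (smul_mono hs1' (riccatiOp_le_cost A B C hX F))
    (smul_mono hs0 (riccatiOp_le_cost A B C hY F))

/-- The defect of the Riccati operator below `Y`: the closed loop of `Y` acting on `Y - X`,
plus a quadratic term in `Y - X`. -/
theorem riccatiOp_sub {X Y : Matrix (Fin n) (Fin n) ℝ} (hX : 0 ≤ X) (hY : 0 ≤ Y) :
    riccatiOp A B C Y - riccatiOp A B C X =
      (A + B * gain A B Y)ᵀ * lift r (Y - X) * (A + B * gain A B Y) +
      (lift r (Y - X) * (A + B * gain A B Y))ᵀ * (B * (weight B X)⁻¹ * Bᵀ) *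
        (lift r (Y - X) * (A + B * gain A B Y)) := by
  have hWY : weight B Y * (weight B Y)⁻¹ = 1 := Matrix.mul_nonsing_inv _ (isUnit_det_weight B hY)
  have hWX : weight B X * (weight B X)⁻¹ = 1 := Matrix.mul_nonsing_inv _ (isUnit_det_weight B hX)
  have hWX' : (weight B X)⁻¹ * weight B X = 1 := Matrix.nonsing_inv_mul _ (isUnit_det_weight B hX)
  set G := gain A B Y with hG
  set N := A + B * G with hN
  have h1 : weight B Y * G = -(Bᵀ * lift r Y * A) := by
    rw [hG, gain, Matrix.mul_neg, ← Matrix.mul_assoc, hWY, Matrix.one_mul]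
  have h2 : weight B X * gain A B X = -(Bᵀ * lift r X * A) := by
    rw [gain, Matrix.mul_neg, ← Matrix.mul_assoc, hWX, Matrix.one_mul]
  have hd : weight B Y - weight B X = Bᵀ * lift r (Y - X) * B := by
    rw [weight, weight, lift_sub, Matrix.mul_sub, Matrix.sub_mul]; abel
  have h3 : weight B X * (G - gain A B X) = -(Bᵀ * (lift r (Y - X) * N)) := by
    have : weight B X * G = weight B Y * G - Bᵀ * lift r (Y - X) * B * G := by
      rw [← hd, Matrix.sub_mul]; abel
    rw [Matrix.mul_sub, this, h1, h2, hN]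
    simp only [lift_sub, Matrix.mul_add, Matrix.mul_sub, Matrix.sub_mul, Matrix.mul_assoc]
    abel
  have h4 : G - gain A B X = -((weight B X)⁻¹ * (Bᵀ * (lift r (Y - X) * N))) := by
    rw [← Matrix.mul_neg, ← h3, ← Matrix.mul_assoc, hWX', Matrix.one_mul]
  have h5 := cost_eq A B C hX G
  have h6 : cost A B C G Y = riccatiOp A B C Y := cost_gain A B C hY
  have h7 : cost A B C G Y - cost A B C G X = Nᵀ * lift r (Y - X) * N := by
    rw [cost, cost, add_sub_add_right_eq_sub, ← map_sub, steinOpAdjoint_blocks]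
  have h8 : riccatiOp A B C Y - riccatiOp A B C X = Nᵀ * lift r (Y - X) * N +
      (G - gain A B X)ᵀ * (weight B X * (G - gain A B X)) := by
    rw [← h7, ← h6, h5, Matrix.mul_assoc]; abel
  rw [h8, h3, h4, Matrix.transpose_neg, Matrix.neg_mul, Matrix.mul_neg, neg_neg,
    Matrix.transpose_mul, Matrix.transpose_nonsing_inv, weight_transpose B hX,
    Matrix.transpose_mul, Matrix.transpose_transpose]
  simp only [Matrix.mul_assoc]

/-- To first order, the defect of the Riccati operator is governed by the closed loop of `Y`. -/
theorem riccatiOp_sub_le {X Y : Matrix (Fin n) (Fin n) ℝ} (hX : 0 ≤ X) (h : X ≤ Y) {b : ℝ}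
    (hb : (B * (weight B X)⁻¹ * Bᵀ).trace ≤ b) :
    riccatiOp A B C Y - riccatiOp A B C X ≤
      (1 + b * (Y - X).trace) • steinOpAdjoint (blocks (A + B * gain A B Y)) (Y - X) := by
  rw [riccatiOp_sub A B C hX (hX.trans h), steinOpAdjoint_blocks]
  set N := A + B * gain A B Y with hN
  set E := Y - X with hE
  have hE0 : 0 ≤ E := sub_nonneg.mpr h
  have hW : 0 ≤ B * (weight B X)⁻¹ * Bᵀ := by
    have := transpose_mul_mul_nonneg (Matrix.nonneg_iff_posSemidef.mpr
      (weight_posDef B hX).inv.posSemidef) Bᵀ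
    rwa [Matrix.transpose_transpose] at this
  have hb0 : 0 ≤ b := (trace_nonneg_of_nonneg hW).trans hb
  have hEs : (lift r E)ᵀ = lift r E := transpose_eq_of_nonneg (lift_nonneg hE0)
  rw [add_smul, one_smul]
  refine add_le_add le_rfl ?_
  calc (lift r E * N)ᵀ * (B * (weight B X)⁻¹ * Bᵀ) * (lift r E * N)
      ≤ (lift r E * N)ᵀ * (b • (1 : Matrix (Fin n × Fin r) (Fin n × Fin r) ℝ)) *
        (lift r E * N) := by
        refine transpose_mul_mul_mono ((le_trace_smul_one hW).trans
          (smul_le_smul_of_nonneg hb ?_)) _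
        simp
    _ = b • (Nᵀ * lift r (E * E) * N) := by
        rw [lift_mul, Matrix.transpose_mul, hEs]
        simp only [Matrix.mul_smul, Matrix.smul_mul, Matrix.mul_one, Matrix.mul_assoc]
    _ ≤ b • (Nᵀ * lift r (E.trace • E) * N) :=
        smul_mono hb0 (transpose_mul_mul_mono (lift_mono (mul_self_le_trace_smul hE0)) _)
    _ = (b * E.trace) • (Nᵀ * lift r E * N) := by
        rw [lift_smul, Matrix.mul_smul, Matrix.smul_mul, smul_smul]

theorem continuousAt_weight_inv {X : Matrix (Fin n) (Fin n) ℝ} (h : 0 ≤ X) :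
    ContinuousAt (fun Y => (weight B Y)⁻¹) X := by
  have hc : Continuous (weight B) := by
    unfold weight
    have := continuous_lift (n := n) (r := r)
    fun_prop
  refine ContinuousAt.comp (f := weight B) (g := fun Z => Z⁻¹)
    (continuousAt_matrix_inv _ ?_) hc.continuousAt
  rw [show (Ring.inverse : ℝ → ℝ) = fun x => x⁻¹ from funext fun x => Ring.inverse_eq_inv x]
  exact continuousAt_inv₀ (isUnit_det_weight B h).ne_zero

theorem tendsto_riccatiOp {X : ℕ → Matrix (Fin n) (Fin n) ℝ} {Y : Matrix (Fin n) (Fin n) ℝ}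
    (hX : ∀ t, 0 ≤ X t) (hY : 0 ≤ Y) (h : Tendsto X atTop (𝓝 Y)) :
    Tendsto (fun t => riccatiOp A B C (X t)) atTop (𝓝 (riccatiOp A B C Y)) := by
  simp only [riccatiOp_eq A B C (hX _), riccatiOp_eq A B C hY]
  have hW := (continuousAt_weight_inv B hY).tendsto.comp h
  have hl := (continuous_lift (n := n) (r := r).tendsto Y).comp h
  have hc : Continuous fun p : Matrix (Fin n × Fin r) (Fin n × Fin r) ℝ × Matrix (Fin m) (Fin m) ℝ
      => Aᵀ * p.1 * A - Aᵀ * p.1 * B * p.2 * (Bᵀ * p.1 * A) + Cᵀ * C := by fun_prop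
  have key := Tendsto.comp (hc.tendsto (lift r Y, (weight B Y)⁻¹)) (hl.prodMk_nhds hW)
  simpa only [Function.comp_def] using key

end Riccati


/-! ### Convergence of the fixed point iteration -/

section Iteration

open scoped MatrixOrder

variable {n m l r : ℕ}

theorem trace_mul_steinOpAdjoint_pow_le {M : Fin r → Matrix (Fin n) (Fin n) ℝ}
    {P : Matrix (Fin n) (Fin n) ℝ} {q : ℝ} (hq : 0 ≤ q) (hP : steinOp M P ≤ q • P)
    {Z : Matrix (Fin n) (Fin n) ℝ} (hZ : 0 ≤ Z) (t : ℕ) :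
    (P * (steinOpAdjoint M ^ t) Z).trace ≤ q ^ t * (P * Z).trace :=
  trace_mul_steinOp_pow_le (M := fun i => (M i)ᵀ) hq
    (by rwa [steinOpAdjoint_transpose]) hZ t

variable (A : Matrix (Fin n × Fin r) (Fin n) ℝ) (B : Matrix (Fin n × Fin r) (Fin m) ℝ)
  (C : Matrix (Fin l) (Fin n) ℝ)

theorem fixedPointIter_nonneg (t : ℕ) : 0 ≤ fixedPointIter A B C t := by
  induction t with
  | zero => exact le_rfl
  | succ t ih => exact riccatiOp_nonneg A B C ih

theorem fixedPointIter_le_succ (t : ℕ) :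
    fixedPointIter A B C t ≤ fixedPointIter A B C (t + 1) := by
  induction t with
  | zero => exact fixedPointIter_nonneg A B C 1
  | succ t ih => exact riccatiOp_mono A B C (fixedPointIter_nonneg A B C t) ih

theorem fixedPointIter_le {X : Matrix (Fin n) (Fin n) ℝ} (hX : 0 ≤ X)
    (hfix : riccatiOp A B C X = X) (t : ℕ) : fixedPointIter A B C t ≤ X := by
  induction t with
  | zero => exact hX
  | succ t ih =>
    exact (riccatiOp_mono A B C (fixedPointIter_nonneg A B C t) ih).trans_eq hfix

theorem fixedPointIter_eq_of_succ_eq {T : ℕ}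
    (h : fixedPointIter A B C (T + 1) = fixedPointIter A B C T) {t : ℕ} (ht : T ≤ t) :
    fixedPointIter A B C t = fixedPointIter A B C T := by
  induction t, ht using Nat.le_induction with
  | base => rfl
  | succ t _ ih => rw [← h, fixedPointIter, fixedPointIter, ih]

/-- A stabilizing feedback has finite cost, which bounds the optimal costs `X_t`. -/
theorem exists_trace_fixedPointIter_le {F : Matrix (Fin m) (Fin n) ℝ}
    (hF : opSpectralRadius (steinOp (blocks (A + B * F))) < 1) :
    ∃ c : ℝ, ∀ t, (fixedPointIter A B C t).trace ≤ c := by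
  obtain ⟨P, q, hP1, hq0, hq1, hP⟩ := exists_lyapunov hF
  have hP0 : 0 ≤ P := one_nonneg_matrix.trans hP1
  set h := (P * (Cᵀ * C + Fᵀ * F)).trace with hh
  have hh0 : 0 ≤ h := trace_mul_nonneg hP0 (runningCost_nonneg C F)
  refine ⟨h / (1 - q), fun t =>
    (trace_le_trace_mul hP1 (fixedPointIter_nonneg A B C t)).trans ?_⟩
  have hq : 0 < 1 - q := by linarith
  induction t with
  | zero => simp only [fixedPointIter, Matrix.mul_zero, Matrix.trace_zero]; positivity
  | succ t ih =>
    have hXt := fixedPointIter_nonneg A B C t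
    calc (P * fixedPointIter A B C (t + 1)).trace
        ≤ (P * cost A B C F (fixedPointIter A B C t)).trace :=
          trace_mul_mono_right hP0 (riccatiOp_le_cost A B C hXt F)
      _ = (steinOp (blocks (A + B * F)) P * fixedPointIter A B C t).trace + h := by
          rw [cost, Matrix.mul_add, Matrix.trace_add, trace_mul_steinOpAdjoint]
      _ ≤ q * (P * fixedPointIter A B C t).trace + h := by
          have := trace_mul_mono_left hP hXt
          rw [Matrix.smul_mul, Matrix.trace_smul, smul_eq_mul] at this
          linarith
      _ ≤ q * (h / (1 - q)) + h := by
          have := mul_le_mul_of_nonneg_left ih hq0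
          linarith
      _ = h / (1 - q) := by field_simp; ring

theorem exists_tendsto_fixedPointIter {F : Matrix (Fin m) (Fin n) ℝ}
    (hF : opSpectralRadius (steinOp (blocks (A + B * F))) < 1) :
    ∃ X, 0 ≤ X ∧ riccatiOp A B C X = X ∧
      Tendsto (fixedPointIter A B C) atTop (𝓝 X) := by
  obtain ⟨c, hc⟩ := exists_trace_fixedPointIter_le A B C hF
  obtain ⟨X, hX⟩ := exists_tendsto_of_monotone (fixedPointIter_nonneg A B C)
    (fixedPointIter_le_succ A B C) hc
  have hX0 : 0 ≤ X := nonneg_of_tendsto hX (fixedPointIter_nonneg A B C)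
  refine ⟨X, hX0, ?_, hX⟩
  exact tendsto_nhds_unique (tendsto_riccatiOp A B C (fixedPointIter_nonneg A B C) hX0 hX)
    (hX.comp (tendsto_add_atTop_nat 1))

theorem eq_steinOpAdjoint_add {X : Matrix (Fin n) (Fin n) ℝ} (hX : 0 ≤ X)
    (hfix : riccatiOp A B C X = X) :
    X = steinOpAdjoint (blocks (A + B * gain A B X)) X +
      (Cᵀ * C + (gain A B X)ᵀ * gain A B X) := by
  conv_lhs => rw [← hfix, ← cost_gain A B C hX]
  rfl

/-- Young's inequality for the congruence by a sum of two matrices. -/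
theorem transpose_mul_mul_add_le {a b : Type*} [Fintype a] [Fintype b] {Z : Matrix a a ℝ}
    (hZ : 0 ≤ Z) (M J : Matrix a b ℝ) {ε : ℝ} (hε : 0 < ε) :
    (M + J)ᵀ * Z * (M + J) ≤ (1 + ε) • (Mᵀ * Z * M) + (1 + ε⁻¹) • (Jᵀ * Z * J) := by
  have h := smul_nonneg_matrix (inv_pos.mpr hε).le (transpose_mul_mul_nonneg hZ (ε • M - J))
  have h1 : (1 + ε) • (Mᵀ * Z * M) + (1 + ε⁻¹) • (Jᵀ * Z * J) - (M + J)ᵀ * Z * (M + J) =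
      ε⁻¹ • ((ε • M - J)ᵀ * Z * (ε • M - J)) := by
    simp only [Matrix.transpose_add, Matrix.transpose_sub, Matrix.transpose_smul, Matrix.add_mul,
      Matrix.mul_add, Matrix.sub_mul, Matrix.mul_sub, Matrix.smul_mul, Matrix.mul_smul, smul_sub,
      smul_smul, ← mul_assoc, inv_mul_cancel₀ hε.ne', one_smul, one_mul, add_smul]
    abel
  rw [← sub_nonneg, h1]
  exact h

theorem transpose_mul_mul_le_trace {a b c : Type*} [Fintype a] [Fintype b] [Fintype c]
    [DecidableEq b] {Z : Matrix a a ℝ} (hZ : 0 ≤ Z) (V : Matrix a b ℝ) (G : Matrix b c ℝ) :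
    (V * G)ᵀ * Z * (V * G) ≤ (Vᵀ * Z * V).trace • (Gᵀ * G) := by
  have := transpose_mul_mul_mono (le_trace_smul_one (transpose_mul_mul_nonneg hZ V)) G
  simpa [Matrix.mul_assoc] using this

/-- Detectability in stacked form: an output injection `K C` stabilizes the adjoint dynamics. -/
theorem Detectable.exists_injection [NeZero r] (hdet : Detectable (blocks A) C) :
    ∃ K : Matrix (Fin n × Fin r) (Fin l) ℝ,
      opSpectralRadius (steinOpAdjoint (blocks (A + K * C))) < 1 := by
  obtain ⟨F, hF⟩ := hdet
  refine ⟨permStack fun i => if i = 0 then Fᵀ else 0, ?_⟩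
  rw [steinOpAdjoint]
  convert hF using 3
  funext i
  ext a b
  by_cases hi : i = 0 <;>
    simp [closedLoop, blocks, permStack, Matrix.mul_apply, hi, mul_comm]

/-- Detectability makes every positive semidefinite solution stabilizing: if `P` is a Lyapunov
matrix for the output injection, then `P + c X` is one for the closed loop, because `X` decreases
along the closed loop by the running cost, which controls the difference of the two dynamics. -/
theorem opSpectralRadius_closedLoop_lt_one [NeZero r] (hdet : Detectable (blocks A) C)
    {X : Matrix (Fin n) (Fin n) ℝ} (hX : 0 ≤ X) (hfix : riccatiOp A B C X = X) :
    opSpectralRadius (steinOp (blocks (A + B * gain A B X))) < 1 := by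
  obtain ⟨K, hK⟩ := hdet.exists_injection
  obtain ⟨P, q, hP1, hq0, hq1, hP⟩ := exists_lyapunov (M := fun i => (blocks (A + K * C) i)ᵀ) hK
  have hP' : steinOpAdjoint (blocks (A + K * C)) P ≤ q • P := hP
  have hP0 : 0 ≤ P := one_nonneg_matrix.trans hP1
  have hlP : 0 ≤ lift r P := lift_nonneg hP0
  have hXeq := eq_steinOpAdjoint_add A B C hX hfix
  set G := gain A B X with hG
  set N := A + B * G with hN
  set Θ := Cᵀ * C + Gᵀ * G with hΘ
  set c₀ := (Bᵀ * lift r P * B).trace + (Kᵀ * lift r P * K).trace with hc₀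
  have hcB : 0 ≤ (Bᵀ * lift r P * B).trace :=
    trace_nonneg_of_nonneg (transpose_mul_mul_nonneg hlP B)
  have hcK : 0 ≤ (Kᵀ * lift r P * K).trace :=
    trace_nonneg_of_nonneg (transpose_mul_mul_nonneg hlP K)
  -- the two closed loops differ by a term controlled by the running cost
  have hJ : (B * G + K * (-C))ᵀ * lift r P * (B * G + K * (-C)) ≤ (2 * c₀) • Θ := by
    refine (transpose_mul_mul_add_le hlP (B * G) (K * (-C)) one_pos).trans ?_
    have h1 := transpose_mul_mul_le_trace hlP B G
    have h2 := transpose_mul_mul_le_trace hlP K (-C)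
    rw [show (-C)ᵀ * -C = Cᵀ * C by simp] at h2
    have hGG := transpose_mul_self_nonneg G
    have hCC := transpose_mul_self_nonneg C
    rw [inv_one, one_add_one_eq_two, ← smul_add, mul_smul]
    refine smul_mono zero_le_two ?_
    rw [hΘ, smul_add, add_comm]
    exact add_le_add (h2.trans (smul_le_smul_of_nonneg (by linarith) hCC))
      (h1.trans (smul_le_smul_of_nonneg (by linarith) hGG))
  set ε := (1 - q) / 2 with hε
  have hε0 : 0 < ε := by rw [hε]; linarith
  have hq' : (1 + ε) * q < 1 := by rw [hε]; nlinarith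
  set κ := (1 + ε⁻¹) * (2 * c₀) with hκ
  have hκ0 : 0 ≤ κ := by positivity
  have hNP : steinOpAdjoint (blocks N) P ≤ ((1 + ε) * q) • P + κ • Θ := by
    have hNeq : N = (A + K * C) + (B * G + K * (-C)) := by
      rw [hN, Matrix.mul_neg]; abel
    rw [steinOpAdjoint_blocks, hNeq]
    refine (transpose_mul_mul_add_le hlP _ _ hε0).trans (add_le_add ?_ ?_)
    · rw [mul_smul, ← steinOpAdjoint_blocks]
      exact smul_mono (by positivity) hP'
    · rw [hκ, mul_smul]
      exact smul_mono (by positivity) hJ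
  have hQ1 : 1 ≤ P + κ • X := hP1.trans (le_add_of_nonneg_right (smul_nonneg_matrix hκ0 hX))
  have hQ : steinOpAdjoint (blocks N) (P + κ • X) ≤
      (P + κ • X) - (1 - (1 + ε) * q) • (1 : Matrix (Fin n) (Fin n) ℝ) := by
    calc steinOpAdjoint (blocks N) (P + κ • X)
        = steinOpAdjoint (blocks N) P + κ • steinOpAdjoint (blocks N) X := by
          rw [map_add, map_smul]
      _ ≤ (((1 + ε) * q) • P + κ • Θ) + κ • steinOpAdjoint (blocks N) X :=
          add_le_add hNP le_rfl
      _ = (P + κ • (steinOpAdjoint (blocks N) X + Θ)) - (1 - (1 + ε) * q) • P := by module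
      _ ≤ (P + κ • X) - (1 - (1 + ε) * q) • (1 : Matrix (Fin n) (Fin n) ℝ) := by
          rw [← hXeq]
          exact sub_le_sub_left (smul_mono (by linarith) hP1) _
  obtain ⟨p, hp0, hp1, hp⟩ := exists_contraction_of_le_sub
    (one_nonneg_matrix.trans hQ1) (by linarith) hQ
  exact opSpectralRadius_lt_one_of_lyapunov hQ1 hp0 hp1 hp

theorem steinOpAdjoint_pow_nonneg (M : Fin r → Matrix (Fin n) (Fin n) ℝ)
    {Z : Matrix (Fin n) (Fin n) ℝ} (h : 0 ≤ Z) (t : ℕ) : 0 ≤ (steinOpAdjoint M ^ t) Z :=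
  steinOp_pow_nonneg _ h t

/-- A stabilizing solution dominates every positive semidefinite solution. -/
theorem le_of_stabilizing {X Z : Matrix (Fin n) (Fin n) ℝ} (hX : 0 ≤ X)
    (hfix : riccatiOp A B C X = X)
    (hst : opSpectralRadius (steinOp (blocks (A + B * gain A B X))) < 1)
    (hZ : 0 ≤ Z) (hZfix : riccatiOp A B C Z = Z) : Z ≤ X := by
  obtain ⟨P, q, hP1, hq0, hq1, hP⟩ := exists_lyapunov hst
  set T := steinOpAdjoint (blocks (A + B * gain A B X)) with hT
  have hstep : Z - X ≤ T (Z - X) := by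
    have h1 := riccatiOp_le_cost A B C hZ (gain A B X)
    have h2 := cost_gain A B C hX
    rw [hZfix] at h1
    rw [hfix] at h2
    calc Z - X ≤ cost A B C (gain A B X) Z - cost A B C (gain A B X) X := by
          rw [h2]; exact sub_le_sub_right h1 X
      _ = T (Z - X) := by rw [cost, cost, add_sub_add_right_eq_sub, ← map_sub]
  have hpow : ∀ t, Z - X ≤ (T ^ t) (Z - X) := by
    intro t
    induction t with
    | zero => simp
    | succ t ih =>
      refine hstep.trans ?_
      rw [pow_succ', Module.End.mul_apply]
      exact steinOpAdjoint_mono _ ih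
  have hbound : ∀ t, Z - X ≤ (q ^ t * (P * Z).trace) • (1 : Matrix (Fin n) (Fin n) ℝ) := by
    intro t
    have hZt : 0 ≤ (T ^ t) Z := steinOpAdjoint_pow_nonneg _ hZ t
    have h1 : (T ^ t) (Z - X) ≤ (T ^ t) Z := by
      rw [map_sub]
      exact sub_le_self _ (steinOpAdjoint_pow_nonneg _ hX t)
    refine (hpow t).trans (h1.trans ((le_trace_smul_one hZt).trans
      (smul_le_smul_of_nonneg ?_ one_nonneg_matrix)))
    exact (trace_le_trace_mul hP1 hZt).trans (trace_mul_steinOpAdjoint_pow_le hq0 hP hZ t)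
  have hlim : Tendsto (fun t : ℕ => (q ^ t * (P * Z).trace) • (1 : Matrix (Fin n) (Fin n) ℝ)
      - (Z - X)) atTop (𝓝 (X - Z)) := by
    have h1 := (tendsto_pow_atTop_nhds_zero_of_lt_one hq0 hq1).mul_const (P * Z).trace
    have h2 := (h1.smul_const (1 : Matrix (Fin n) (Fin n) ℝ)).sub_const (Z - X)
    simpa using h2
  exact sub_nonneg.mp (nonneg_of_tendsto hlim fun t => sub_nonneg.mpr (hbound t))

end Iteration

/-! ### The error of the iteration -/

section Error

open scoped MatrixOrder

variable {n m l r : ℕ} {A : Matrix (Fin n × Fin r) (Fin n) ℝ}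
  {B : Matrix (Fin n × Fin r) (Fin m) ℝ} {C : Matrix (Fin l) (Fin n) ℝ}
  {X : Matrix (Fin n) (Fin n) ℝ}

theorem exists_error_succ_le (hX : 0 ≤ X) (hfix : riccatiOp A B C X = X)
    (hlim : Tendsto (fixedPointIter A B C) atTop (𝓝 X)) :
    ∃ b : ℝ, 0 ≤ b ∧ ∀ t, X - fixedPointIter A B C (t + 1) ≤
      (1 + b * (X - fixedPointIter A B C t).trace) •
        steinOpAdjoint (blocks (A + B * gain A B X)) (X - fixedPointIter A B C t) := by
  have hW : Tendsto (fun t => (B * (weight B (fixedPointIter A B C t))⁻¹ * Bᵀ).trace) atTop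
      (𝓝 (B * (weight B X)⁻¹ * Bᵀ).trace) := by
    have h1 := (continuousAt_weight_inv B hX).tendsto.comp hlim
    have hc : Continuous fun W : Matrix (Fin m) (Fin m) ℝ => (B * W * Bᵀ).trace := by fun_prop
    have key := (hc.tendsto (weight B X)⁻¹).comp h1
    simpa only [Function.comp_def] using key
  obtain ⟨b, hb⟩ := hW.bddAbove_range
  refine ⟨max b 0, le_max_right _ _, fun t => ?_⟩
  have := riccatiOp_sub_le A B C (fixedPointIter_nonneg A B C t)
    (fixedPointIter_le A B C hX hfix t) ((hb ⟨t, rfl⟩).trans (le_max_left b 0))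
  rwa [hfix] at this

/-- Once `tr E_t` is small, the error contracts in the norm `E ↦ tr (P E)` given by a Lyapunov
matrix `P` of the closed loop. -/
theorem summable_trace_error (hX : 0 ≤ X) (hfix : riccatiOp A B C X = X)
    (hlim : Tendsto (fixedPointIter A B C) atTop (𝓝 X))
    (hst : opSpectralRadius (steinOp (blocks (A + B * gain A B X))) < 1) :
    Summable fun t => (X - fixedPointIter A B C t).trace := by
  obtain ⟨b, hb0, hb⟩ := exists_error_succ_le hX hfix hlim
  obtain ⟨P, q, hP1, hq0, hq1, hP⟩ := exists_lyapunov hst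
  have hP0 : 0 ≤ P := one_nonneg_matrix.trans hP1
  have hE : ∀ t, 0 ≤ X - fixedPointIter A B C t := fun t =>
    sub_nonneg.mpr (fixedPointIter_le A B C hX hfix t)
  have htr : Tendsto (fun t => (1 + b * (X - fixedPointIter A B C t).trace) * q) atTop
      (𝓝 q) := by
    have hc : Continuous fun Z : Matrix (Fin n) (Fin n) ℝ => (1 + b * (X - Z).trace) * q := by
      fun_prop
    simpa [Function.comp_def] using (hc.tendsto X).comp hlim
  obtain ⟨p, hqp, hp1⟩ := exists_between hq1
  have hsum : Summable fun t => (P * (X - fixedPointIter A B C t)).trace := by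
    refine summable_of_ratio_norm_eventually_le hp1 ?_
    filter_upwards [htr.eventually (gt_mem_nhds hqp)] with t ht
    rw [Real.norm_of_nonneg (trace_mul_nonneg hP0 (hE _)),
      Real.norm_of_nonneg (trace_mul_nonneg hP0 (hE _))]
    have h1 := trace_mul_mono_right hP0 (hb t)
    have h2 := trace_mul_mono_left hP (hE t)
    have h3 := trace_nonneg_of_nonneg (hE t)
    rw [Matrix.mul_smul, Matrix.trace_smul, smul_eq_mul, trace_mul_steinOpAdjoint] at h1
    rw [Matrix.smul_mul, Matrix.trace_smul, smul_eq_mul] at h2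
    calc _ ≤ _ := h1
      _ ≤ (1 + b * (X - fixedPointIter A B C t).trace) *
          (q * (P * (X - fixedPointIter A B C t)).trace) :=
          mul_le_mul_of_nonneg_left h2 (by positivity)
      _ = ((1 + b * (X - fixedPointIter A B C t).trace) * q) *
          (P * (X - fixedPointIter A B C t)).trace := by ring
      _ ≤ _ := mul_le_mul_of_nonneg_right ht.le (trace_mul_nonneg hP0 (hE t))
  exact Summable.of_nonneg_of_le (fun t => trace_nonneg_of_nonneg (hE t))
    (fun t => trace_le_trace_mul hP1 (hE t)) hsum

/-- The nonlinear error recursion is dominated by its linearization, up to a constant: the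
correction factors `1 + b tr E_s` have a convergent product. -/
theorem exists_error_le_pow (hX : 0 ≤ X) (hfix : riccatiOp A B C X = X)
    (hlim : Tendsto (fixedPointIter A B C) atTop (𝓝 X))
    (hst : opSpectralRadius (steinOp (blocks (A + B * gain A B X))) < 1) :
    ∃ κ : ℝ, 1 < κ ∧ ∀ t, X - fixedPointIter A B C t ≤
      κ • (steinOpAdjoint (blocks (A + B * gain A B X)) ^ t) X := by
  obtain ⟨b, hb0, hb⟩ := exists_error_succ_le hX hfix hlim
  have hsum := summable_trace_error hX hfix hlim hst
  have hE : ∀ t, 0 ≤ X - fixedPointIter A B C t := fun t =>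
    sub_nonneg.mpr (fixedPointIter_le A B C hX hfix t)
  have he : ∀ t, 0 ≤ (X - fixedPointIter A B C t).trace := fun t => trace_nonneg_of_nonneg (hE t)
  set T := steinOpAdjoint (blocks (A + B * gain A B X)) with hT
  have hprod : ∀ t, X - fixedPointIter A B C t ≤
      (∏ s ∈ Finset.range t, (1 + b * (X - fixedPointIter A B C s).trace)) • (T ^ t) X := by
    intro t
    induction t with
    | zero => simp [fixedPointIter]
    | succ t ih =>
      have hf : 0 ≤ 1 + b * (X - fixedPointIter A B C t).trace := by
        have := mul_nonneg hb0 (he t); linarith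
      refine (hb t).trans ((smul_mono hf (steinOpAdjoint_mono _ ih)).trans_eq ?_)
      rw [map_smul, smul_smul, Finset.prod_range_succ, mul_comm, pow_succ', Module.End.mul_apply]
  refine ⟨Real.exp (b * ∑' s, (X - fixedPointIter A B C s).trace) + 1,
    by linarith [Real.exp_pos (b * ∑' s, (X - fixedPointIter A B C s).trace)], fun t => ?_⟩
  refine (hprod t).trans (smul_le_smul_of_nonneg ?_ (steinOpAdjoint_pow_nonneg _ hX t))
  calc ∏ s ∈ Finset.range t, (1 + b * (X - fixedPointIter A B C s).trace)
      ≤ ∏ s ∈ Finset.range t, Real.exp (b * (X - fixedPointIter A B C s).trace) := by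
        refine Finset.prod_le_prod (fun s _ => ?_) fun s _ => ?_
        · have := mul_nonneg hb0 (he s); linarith
        · rw [add_comm]; exact Real.add_one_le_exp _
    _ = Real.exp (b * ∑ s ∈ Finset.range t, (X - fixedPointIter A B C s).trace) := by
        rw [← Real.exp_sum, Finset.mul_sum]
    _ ≤ Real.exp (b * ∑' s, (X - fixedPointIter A B C s).trace) :=
        Real.exp_le_exp.mpr (mul_le_mul_of_nonneg_left
          (hsum.sum_le_tsum _ fun s _ => he s) hb0)
    _ ≤ _ := by linarith

/-- For `κ > 1`, a positive definite `Y` can be chosen so that `X (1 - Y X)⁻¹` is `κ X`, namely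
`1 - κ⁻¹` times a generalized inverse of `X`. -/
theorem exists_posDef_mul_inv_eq_smul (hX : 0 ≤ X) {κ : ℝ} (hκ : 1 < κ) :
    ∃ Y : Matrix (Fin n) (Fin n) ℝ, Y.PosDef ∧ IsUnit (1 - Y * X) ∧
      X * (1 - Y * X)⁻¹ = κ • X := by
  obtain ⟨Y, hY, hcomm, hXYX⟩ := exists_posDef_generalized_inverse hX
  have hκ0 : 0 < κ := by linarith
  have hPP : Y * X * (Y * X) = Y * X := by
    rw [Matrix.mul_assoc, ← Matrix.mul_assoc X, hXYX]
  -- `Y X` is the projection onto the range of `X`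
  have hinv : (1 - ((1 - κ⁻¹) • Y) * X) * (1 + (κ - 1) • (Y * X)) = 1 := by
    have h0 : κ - 1 - (1 - κ⁻¹) - (1 - κ⁻¹) * (κ - 1) = 0 := by field_simp; ring
    rw [Matrix.smul_mul, Matrix.sub_mul, Matrix.mul_add, Matrix.mul_add, Matrix.smul_mul,
      Matrix.mul_smul, Matrix.mul_smul, Matrix.smul_mul, hPP]
    simp only [Matrix.one_mul, Matrix.mul_one]
    rw [← sub_eq_zero]
    calc _ = (κ - 1 - (1 - κ⁻¹) - (1 - κ⁻¹) * (κ - 1)) • (Y * X) := by module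
      _ = 0 := by rw [h0, zero_smul]
  refine ⟨(1 - κ⁻¹) • Y, hY.smul (by rw [sub_pos]; exact inv_lt_one_of_one_lt₀ hκ),
    (Matrix.isUnit_iff_isUnit_det _).mpr (Matrix.isUnit_det_of_right_inverse hinv), ?_⟩
  rw [Matrix.inv_eq_right_inv hinv, Matrix.mul_add, Matrix.mul_one, Matrix.mul_smul,
    ← Matrix.mul_assoc, hXYX]
  module

/-- The error map is order preserving and convex with fixed point `0`, so a bound of the error
at time `t` by a fraction of the initial error `X` propagates along the iteration. -/
theorem error_add_le (hX : 0 ≤ X) (hfix : riccatiOp A B C X = X) {t : ℕ} {a : ℝ} (ha0 : 0 ≤ a)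
    (ha1 : a ≤ 1) (h : X - fixedPointIter A B C t ≤ a • X) (s : ℕ) :
    X - fixedPointIter A B C (t + s) ≤ a • (X - fixedPointIter A B C s) := by
  induction s with
  | zero => simpa [fixedPointIter] using h
  | succ s ih =>
    have hXs := fixedPointIter_nonneg A B C s
    have h1 : (1 - a) • X + a • fixedPointIter A B C s ≤ fixedPointIter A B C (t + s) := by
      rw [← sub_nonneg] at ih ⊢
      refine ih.trans_eq ?_
      module
    have h0 : 0 ≤ (1 - a) • X + a • fixedPointIter A B C s :=
      add_nonneg (smul_nonneg_matrix (by linarith) hX) (smul_nonneg_matrix ha0 hXs)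
    have h2 := (riccatiOp_concave A B C hX hXs ha0 ha1).trans (riccatiOp_mono A B C h0 h1)
    rw [hfix] at h2
    change (1 - a) • X + a • fixedPointIter A B C (s + 1) ≤
      fixedPointIter A B C (t + (s + 1)) at h2
    rw [← sub_nonneg] at h2 ⊢
    refine h2.trans_eq ?_
    module

/-- The traces of the errors are submultiplicative up to a constant. -/
theorem exists_trace_error_add_le (hX : 0 ≤ X) (hfix : riccatiOp A B C X = X) :
    ∃ k : ℝ, 0 < k ∧ ∀ t s, (X - fixedPointIter A B C (t + s)).trace ≤
      k * (X - fixedPointIter A B C t).trace * (X - fixedPointIter A B C s).trace := by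
  obtain ⟨k, hk, h⟩ := exists_le_trace_smul hX
  have hE : ∀ t, 0 ≤ X - fixedPointIter A B C t := fun t =>
    sub_nonneg.mpr (fixedPointIter_le A B C hX hfix t)
  refine ⟨k, hk, fun t s => ?_⟩
  have hEX : X - fixedPointIter A B C t ≤ X := sub_le_self _ (fixedPointIter_nonneg A B C t)
  have hkt : 0 ≤ k * (X - fixedPointIter A B C t).trace :=
    mul_nonneg hk.le (trace_nonneg_of_nonneg (hE t))
  have key : X - fixedPointIter A B C (t + s) ≤
      (min 1 (k * (X - fixedPointIter A B C t).trace)) • (X - fixedPointIter A B C s) := by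
    refine error_add_le hX hfix (le_min zero_le_one hkt) (min_le_left _ _) ?_ s
    rcases min_choice 1 (k * (X - fixedPointIter A B C t).trace) with h1 | h1 <;> rw [h1]
    · simpa using fixedPointIter_nonneg A B C t
    · exact h _ (hE t) hEX
  have := trace_mono_of_le (key.trans (smul_le_smul_of_nonneg (min_le_right _ _) (hE s)))
  rwa [Matrix.trace_smul, smul_eq_mul] at this

/-- The error is `O(c ^ t)` for every `c` above the spectral radius of the closed loop. -/
theorem exists_trace_error_le (hX : 0 ≤ X) (hfix : riccatiOp A B C X = X)
    (hlim : Tendsto (fixedPointIter A B C) atTop (𝓝 X))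
    (hst : opSpectralRadius (steinOp (blocks (A + B * gain A B X))) < 1) {c : ℝ}
    (hc : opSpectralRadius (steinOp (blocks (A + B * gain A B X))) < ENNReal.ofReal c) :
    ∃ K : ℝ, ∀ t, (X - fixedPointIter A B C t).trace ≤ K * c ^ t := by
  obtain ⟨κ, hκ, h⟩ := exists_error_le_pow hX hfix hlim hst
  obtain ⟨K, hK⟩ := exists_trace_steinOp_pow_le hc
  refine ⟨κ * (K * X.trace), fun t => ?_⟩
  have h1 := trace_mono_of_le (h t)
  have h2 := trace_mul_steinOpAdjoint_pow (blocks (A + B * gain A B X)) 1 X t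
  rw [Matrix.one_mul] at h2
  rw [Matrix.trace_smul, smul_eq_mul, h2] at h1
  have h3 := trace_mul_le_trace_mul_trace
    (steinOp_pow_nonneg (blocks (A + B * gain A B X)) one_nonneg_matrix t) hX
  have h4 := mul_le_mul_of_nonneg_right (hK t) (trace_nonneg_of_nonneg hX)
  calc _ ≤ _ := h1
    _ ≤ κ * (K * c ^ t * X.trace) := mul_le_mul_of_nonneg_left (h3.trans h4) (by linarith)
    _ = _ := by ring

end Error


/-! ### Root limits of submultiplicative sequences -/

/-- The multiplicative form of Fekete's lemma, without a lower bound: the limit may be `0`. -/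
theorem exists_tendsto_rpow_of_submultiplicative {u : ℕ → ℝ} (h0 : ∀ t, 0 ≤ u t)
    (hu : ∀ t s, u (t + s) ≤ u t * u s) :
    ∃ ℓ : ℝ, Tendsto (fun t : ℕ => u t ^ (1 / (t : ℝ))) atTop (𝓝 ℓ) := by
  by_cases hz : ∃ T, u T = 0
  · obtain ⟨T, hT⟩ := hz
    refine ⟨0, tendsto_const_nhds.congr' ?_⟩
    filter_upwards [eventually_ge_atTop T, eventually_gt_atTop 0] with t ht ht0
    have h1 := hu T (t - T)
    rw [Nat.add_sub_cancel' ht, hT, zero_mul] at h1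
    rw [le_antisymm h1 (h0 t), Real.zero_rpow (by positivity)]
  · push Not at hz
    have hpos : ∀ t, 0 < u t := fun t => lt_of_le_of_ne (h0 t) (Ne.symm (hz t))
    have hsub : Subadditive fun t => Real.log (u t) := fun t s => by
      rw [← Real.log_mul (hz t) (hz s)]
      exact Real.log_le_log (hpos _) (hu t s)
    have hroot : ∀ t : ℕ, u t ^ (1 / (t : ℝ)) = Real.exp (Real.log (u t) / t) := fun t => by
      rw [Real.rpow_def_of_pos (hpos t), mul_one_div]
    simp only [hroot]
    by_cases hb : BddBelow (Set.range fun t : ℕ => Real.log (u t) / t)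
    · exact ⟨_, (Real.continuous_exp.tendsto _).comp (hsub.tendsto_lim hb)⟩
    · refine ⟨0, Real.tendsto_exp_atBot.comp (tendsto_atBot.mpr fun L => ?_)⟩
      have : ∃ t : ℕ, t ≠ 0 ∧ Real.log (u t) / t < L := by
        by_contra! hcon
        refine hb ⟨min L 0, ?_⟩
        rintro _ ⟨t, rfl⟩
        rcases eq_or_ne t 0 with rfl | ht
        · simp
        · exact (min_le_left _ _).trans (hcon t ht)
      obtain ⟨t, ht, htL⟩ := this
      exact (hsub.eventually_div_lt_of_div_lt ht htL).mono fun s hs => hs.le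

theorem tendsto_const_rpow_one_div {c : ℝ} (hc : 0 < c) :
    Tendsto (fun t : ℕ => c ^ (1 / (t : ℝ))) atTop (𝓝 1) := by
  have h := (Real.continuousAt_const_rpow (a := c) (b := 0) hc.ne').tendsto.comp
    tendsto_one_div_atTop_nhds_zero_nat
  simpa [Function.comp_def] using h

/-- If `u` is submultiplicative up to a constant, and `v` is comparable with `u`, then the roots
of `v` converge. -/
theorem exists_tendsto_rpow_of_comparable {u v : ℕ → ℝ} {k c d : ℝ} (hk : 0 < k) (hc : 0 < c)
    (hd : 0 < d) (h0 : ∀ t, 0 ≤ u t) (hu : ∀ t s, u (t + s) ≤ k * u t * u s)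
    (hcv : ∀ t, c * u t ≤ v t) (hvd : ∀ t, v t ≤ d * u t) :
    ∃ ℓ : ℝ, Tendsto (fun t : ℕ => v t ^ (1 / (t : ℝ))) atTop (𝓝 ℓ) := by
  obtain ⟨ℓ, hℓ⟩ := exists_tendsto_rpow_of_submultiplicative (u := fun t => k * u t)
    (fun t => mul_nonneg hk.le (h0 t)) fun t s => by
      calc k * u (t + s) ≤ k * (k * u t * u s) := mul_le_mul_of_nonneg_left (hu t s) hk.le
        _ = _ := by ring
  have hscale : ∀ e : ℝ, 0 < e →
      Tendsto (fun t : ℕ => (e * u t) ^ (1 / (t : ℝ))) atTop (𝓝 ℓ) := by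
    intro e he
    have h := (tendsto_const_rpow_one_div (div_pos he hk)).mul hℓ
    rw [one_mul] at h
    refine h.congr fun t => ?_
    rw [← Real.mul_rpow (div_pos he hk).le (mul_nonneg hk.le (h0 t)), ← mul_assoc,
      div_mul_cancel₀ _ hk.ne']
  refine ⟨ℓ, tendsto_of_tendsto_of_tendsto_of_le_of_le (hscale c hc) (hscale d hd)
    (fun t => ?_) fun t => ?_⟩
  · exact Real.rpow_le_rpow (mul_nonneg hc.le (h0 t)) (hcv t) (by positivity)
  · exact Real.rpow_le_rpow ((mul_nonneg hc.le (h0 t)).trans (hcv t)) (hvd t) (by positivity)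

theorem le_of_tendsto_rpow {v : ℕ → ℝ} {ℓ K c : ℝ} (hc : 0 ≤ c) (h0 : ∀ t, 0 ≤ v t)
    (hv : ∀ t, v t ≤ K * c ^ t)
    (hℓ : Tendsto (fun t : ℕ => v t ^ (1 / (t : ℝ))) atTop (𝓝 ℓ)) : ℓ ≤ c := by
  have hK : 0 < max K 1 := lt_max_of_lt_right one_pos
  have hlim := (tendsto_const_rpow_one_div hK).mul_const c
  rw [one_mul] at hlim
  refine le_of_tendsto_of_tendsto hℓ hlim ?_
  filter_upwards [eventually_gt_atTop 0] with t ht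
  have h1 : v t ≤ max K 1 * c ^ t :=
    (hv t).trans (mul_le_mul_of_nonneg_right (le_max_left K 1) (pow_nonneg hc t))
  refine (Real.rpow_le_rpow (h0 t) h1 (by positivity)).trans_eq ?_
  rw [Real.mul_rpow hK.le (pow_nonneg hc t), one_div, Real.pow_rpow_inv_natCast hc ht.ne']

/-! ### The induced norm and the trace -/

section InducedNorm

open scoped MatrixOrder

variable {n : ℕ}

theorem inducedNorm_sub_comm (X Y : Matrix (Fin n) (Fin n) ℝ) :
    inducedNorm (X - Y) = inducedNorm (Y - X) := by
  rw [inducedNorm, inducedNorm, map_sub, map_sub, norm_sub_rev]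

theorem inducedNorm_pos {X : Matrix (Fin n) (Fin n) ℝ} (h : X ≠ 0) : 0 < inducedNorm X := by
  rw [inducedNorm, norm_pos_iff]
  simpa using h

theorem inducedNorm_le_trace {X : Matrix (Fin n) (Fin n) ℝ} (h : 0 ≤ X) :
    inducedNorm X ≤ X.trace := by
  refine ContinuousLinearMap.opNorm_le_bound _ (trace_nonneg_of_nonneg h) fun x => ?_
  have hsq : ∀ y : EuclideanSpace ℝ (Fin n), ‖y‖ ^ 2 = y.ofLp ⬝ᵥ y.ofLp := fun y => by
    rw [EuclideanSpace.norm_sq_eq]; simp [dotProduct, sq]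
  refine le_of_sq_le_sq ?_ (mul_nonneg (trace_nonneg_of_nonneg h) (norm_nonneg x))
  rw [mul_pow, hsq, hsq, Matrix.ofLp_toEuclideanCLM]
  set v := x.ofLp
  have h1 : (X *ᵥ v) ⬝ᵥ (X *ᵥ v) = v ⬝ᵥ (X * X) *ᵥ v := by
    rw [← Matrix.mulVec_mulVec, Matrix.dotProduct_mulVec v, ← Matrix.mulVec_transpose,
      transpose_eq_of_nonneg h]
  have h2 := dotProduct_mulVec_mono (mul_self_le_trace_smul h) v
  have h3 := dotProduct_mulVec_mono (le_trace_smul_one h) v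
  rw [Matrix.smul_mulVec, dotProduct_smul, smul_eq_mul] at h2 h3
  rw [Matrix.one_mulVec] at h3
  rw [h1]
  nlinarith [mul_le_mul_of_nonneg_left h3 (trace_nonneg_of_nonneg h)]

theorem trace_le_mul_inducedNorm (X : Matrix (Fin n) (Fin n) ℝ) :
    X.trace ≤ n * inducedNorm X := by
  have h : ∀ i, X i i ≤ inducedNorm X := by
    intro i
    set e : EuclideanSpace ℝ (Fin n) := EuclideanSpace.single i 1 with he
    have h1 : X i i = inner ℝ e (Matrix.toEuclideanCLM (n := Fin n) (𝕜 := ℝ) X e) := by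
      rw [he, EuclideanSpace.inner_single_left, Matrix.ofLp_toEuclideanCLM]
      simp
    have h2 := (Matrix.toEuclideanCLM (n := Fin n) (𝕜 := ℝ) X).le_opNorm e
    have h3 := real_inner_le_norm e (Matrix.toEuclideanCLM (n := Fin n) (𝕜 := ℝ) X e)
    have h4 : ‖e‖ = 1 := by simp [he]
    rw [h4, one_mul] at h3
    rw [h4, mul_one] at h2
    rw [h1]
    exact h3.trans h2
  calc X.trace = ∑ i, X i i := rfl
    _ ≤ ∑ _i : Fin n, inducedNorm X := Finset.sum_le_sum fun i _ => h i
    _ = n * inducedNorm X := by simp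

end InducedNorm


/-! ### The asymptotic rate -/

section Rate

open scoped MatrixOrder

variable {n m l r : ℕ} {A : Matrix (Fin n × Fin r) (Fin n) ℝ}
  {B : Matrix (Fin n × Fin r) (Fin m) ℝ} {C : Matrix (Fin l) (Fin n) ℝ}
  {X : Matrix (Fin n) (Fin n) ℝ}

theorem exists_tendsto_error_rpow (hX : 0 ≤ X) (hfix : riccatiOp A B C X = X)
    (hlim : Tendsto (fixedPointIter A B C) atTop (𝓝 X))
    (hst : opSpectralRadius (steinOp (blocks (A + B * gain A B X))) < 1) (hne : X ≠ 0) :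
    ∃ ℓ : ℝ, Tendsto (fun t : ℕ =>
        (inducedNorm (fixedPointIter A B C t - X) / inducedNorm X) ^ (1 / (t : ℝ))) atTop (𝓝 ℓ) ∧
      ENNReal.ofReal ℓ ≤ opSpectralRadius (steinOp (blocks (A + B * gain A B X))) := by
  have hE : ∀ t, 0 ≤ X - fixedPointIter A B C t := fun t =>
    sub_nonneg.mpr (fixedPointIter_le A B C hX hfix t)
  have he : ∀ t, 0 ≤ (X - fixedPointIter A B C t).trace := fun t => trace_nonneg_of_nonneg (hE t)
  have hN : 0 < inducedNorm X := inducedNorm_pos hne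
  have hupper : ∀ t, inducedNorm (fixedPointIter A B C t - X) / inducedNorm X ≤
      (inducedNorm X)⁻¹ * (X - fixedPointIter A B C t).trace := fun t => by
    rw [inducedNorm_sub_comm, div_eq_inv_mul]
    exact mul_le_mul_of_nonneg_left (inducedNorm_le_trace (hE t)) (inv_pos.mpr hN).le
  obtain ⟨k, hk, hsub⟩ := exists_trace_error_add_le hX hfix
  obtain ⟨ℓ, hℓ⟩ := exists_tendsto_rpow_of_comparable
    (v := fun t => inducedNorm (fixedPointIter A B C t - X) / inducedNorm X)
    (c := ((n + 1 : ℝ) * inducedNorm X)⁻¹) hk (by positivity) (inv_pos.mpr hN) he hsub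
    (fun t => by
      rw [inducedNorm_sub_comm, mul_inv, mul_assoc, div_eq_inv_mul, ← mul_assoc,
        mul_comm _ (inducedNorm X)⁻¹, mul_assoc]
      refine mul_le_mul_of_nonneg_left ?_ (inv_pos.mpr hN).le
      rw [inv_mul_le_iff₀ (by positivity)]
      refine (trace_le_mul_inducedNorm _).trans
        (mul_le_mul_of_nonneg_right (by linarith) (norm_nonneg _))) hupper
  -- it suffices to bound `ℓ` by every real `c' > ρ`
  refine ⟨ℓ, hℓ, le_of_forall_gt_imp_ge_of_dense fun c hc => ?_⟩
  obtain ⟨c', hc'0, hc', hcc'⟩ := ENNReal.lt_iff_exists_real_btwn.mp hc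
  obtain ⟨K, hK⟩ := exists_trace_error_le hX hfix hlim hst hc'
  refine (ENNReal.ofReal_le_ofReal ?_).trans hcc'.le
  refine le_of_tendsto_rpow (K := (inducedNorm X)⁻¹ * K) hc'0
    (fun t => div_nonneg (norm_nonneg _) hN.le) (fun t => (hupper t).trans ?_) hℓ
  rw [mul_assoc]
  exact mul_le_mul_of_nonneg_left (hK t) (inv_pos.mpr hN).le

end Rate

/-! ### Reduction to the standard form -/

section StandardForm

open scoped MatrixOrder

variable {n m r : ℕ} (A : Fin r → Matrix (Fin n) (Fin n) ℝ)
  (B : Fin r → Matrix (Fin n) (Fin m) ℝ) (L : Matrix (Fin n) (Fin m) ℝ)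
  {R : Matrix (Fin m) (Fin m) ℝ}

theorem sqrt_mul_sqrt_of_posDef (hR : R.PosDef) : CFC.sqrt R * CFC.sqrt R = R :=
  CFC.sqrt_mul_sqrt_self R (Matrix.nonneg_iff_posSemidef.mpr hR.posSemidef)

theorem isUnit_det_sqrt_of_posDef (hR : R.PosDef) : IsUnit (CFC.sqrt R).det := by
  have h : IsUnit R.det := (Matrix.isUnit_iff_isUnit_det _).mp hR.isUnit
  rw [← sqrt_mul_sqrt_of_posDef hR, Matrix.det_mul] at h
  exact isUnit_of_mul_isUnit_left h

/-- In the standard form the feedback variable is `R^{1/2} (F + R⁻¹ Lᵀ)`. -/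
theorem blocks_stdA_add_stdB_mul (hR : R.PosDef) (F : Matrix (Fin m) (Fin n) ℝ) :
    blocks (stdA A B L R + stdB B R * (CFC.sqrt R * (F + R⁻¹ * Lᵀ))) = closedLoop A B F := by
  have h : stdB B R * (CFC.sqrt R * (F + R⁻¹ * Lᵀ)) = permStack B * (F + R⁻¹ * Lᵀ) := by
    rw [stdB, Matrix.mul_assoc, ← Matrix.mul_assoc (CFC.sqrt R)⁻¹,
      Matrix.nonsing_inv_mul _ (isUnit_det_sqrt_of_posDef hR), Matrix.one_mul]
  rw [h]
  funext i
  have h2 : blocks (stdA A B L R + permStack B * (F + R⁻¹ * Lᵀ)) i =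
      (A i - B i * R⁻¹ * Lᵀ) + B i * (F + R⁻¹ * Lᵀ) := by
    ext a b
    simp [blocks, stdA, stdABlocks, permStack, Matrix.mul_apply]
  rw [h2, closedLoop, Matrix.mul_add, Matrix.mul_assoc]
  abel

theorem weight_stdB (hR : R.PosDef) (X : Matrix (Fin n) (Fin n) ℝ) :
    weight (stdB B R) X =
      (CFC.sqrt R)⁻¹ * (∑ i, (B i)ᵀ * X * B i + R) * (CFC.sqrt R)⁻¹ := by
  have hS := isUnit_det_sqrt_of_posDef hR
  have hSs : (CFC.sqrt R)ᵀ = CFC.sqrt R := transpose_eq_of_nonneg (CFC.sqrt_nonneg R)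
  have h1 : (CFC.sqrt R)⁻¹ * R * (CFC.sqrt R)⁻¹ = 1 := by
    nth_rw 2 [← sqrt_mul_sqrt_of_posDef hR]
    rw [← Matrix.mul_assoc, Matrix.nonsing_inv_mul _ hS, Matrix.one_mul,
      Matrix.mul_nonsing_inv _ hS]
  rw [weight, stdB, Matrix.transpose_mul, Matrix.transpose_nonsing_inv, hSs, Matrix.mul_add,
    Matrix.add_mul, h1, ← transpose_permStack_mul, add_comm]
  simp only [Matrix.mul_assoc]

theorem gain_std (hR : R.PosDef) {X : Matrix (Fin n) (Fin n) ℝ} (hX : 0 ≤ X) :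
    gain (stdA A B L R) (stdB B R) X = CFC.sqrt R * (feedback A B L R X + R⁻¹ * Lᵀ) := by
  set S := CFC.sqrt R with hSdef
  have hS : IsUnit S.det := isUnit_det_sqrt_of_posDef hR
  have hSs : Sᵀ = S := transpose_eq_of_nonneg (CFC.sqrt_nonneg R)
  have hRu : IsUnit R.det := (Matrix.isUnit_iff_isUnit_det _).mp hR.isUnit
  set W := ∑ i, (B i)ᵀ * X * B i + R with hW
  have hWu : IsUnit W.det := by
    have h := isUnit_det_weight (stdB B R) hX
    rw [weight_stdB B hR, Matrix.det_mul, Matrix.det_mul] at h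
    exact isUnit_of_mul_isUnit_right (isUnit_of_mul_isUnit_left h)
  have hWinv : (weight (stdB B R) X)⁻¹ = S * W⁻¹ * S := by
    rw [weight_stdB B hR, Matrix.mul_inv_rev, Matrix.mul_inv_rev,
      Matrix.nonsing_inv_nonsing_inv _ hS, Matrix.mul_assoc]
  have hBA : (stdB B R)ᵀ * lift r X * stdA A B L R =
      S⁻¹ * ∑ i, (B i)ᵀ * X * stdABlocks A B L R i := by
    rw [stdB, stdA, Matrix.transpose_mul, Matrix.transpose_nonsing_inv, hSs,
      ← transpose_permStack_mul]
    simp only [Matrix.mul_assoc]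
  have hsum : ∑ i, (B i)ᵀ * X * stdABlocks A B L R i =
      ∑ i, (B i)ᵀ * X * A i - (W - R) * (R⁻¹ * Lᵀ) := by
    rw [hW, add_sub_cancel_right, Matrix.sum_mul, ← Finset.sum_sub_distrib]
    refine Finset.sum_congr rfl fun i _ => ?_
    rw [stdABlocks, Matrix.mul_sub]
    simp only [Matrix.mul_assoc]
  have hT : (∑ i, (A i)ᵀ * X * B i + L)ᵀ = ∑ i, (B i)ᵀ * X * A i + Lᵀ := by
    simp only [Matrix.transpose_add, Matrix.transpose_sum, Matrix.transpose_mul,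
      Matrix.transpose_transpose, transpose_eq_of_nonneg hX, Matrix.mul_assoc]
  have hRL : R * (R⁻¹ * Lᵀ) = Lᵀ := by
    rw [← Matrix.mul_assoc, Matrix.mul_nonsing_inv _ hRu, Matrix.one_mul]
  have hWL : W⁻¹ * (W * (R⁻¹ * Lᵀ)) = R⁻¹ * Lᵀ := by
    rw [← Matrix.mul_assoc, Matrix.nonsing_inv_mul _ hWu, Matrix.one_mul]
  have hSS : S * W⁻¹ * S * (S⁻¹ * ∑ i, (B i)ᵀ * X * stdABlocks A B L R i) =
      S * (W⁻¹ * ∑ i, (B i)ᵀ * X * stdABlocks A B L R i) := by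
    rw [← Matrix.mul_assoc, Matrix.mul_assoc (S * W⁻¹), Matrix.mul_nonsing_inv _ hS,
      Matrix.mul_one, Matrix.mul_assoc]
  rw [gain, hWinv, hBA, hSS, feedback, hT, ← hW, hsum]
  simp only [Matrix.mul_add, Matrix.mul_sub, Matrix.mul_neg, Matrix.sub_mul, hRL, hWL]
  abel

theorem blocks_closedLoop_std (hR : R.PosDef) {X : Matrix (Fin n) (Fin n) ℝ} (hX : 0 ≤ X) :
    blocks (stdA A B L R + stdB B R * gain (stdA A B L R) (stdB B R) X) =
      feedbackLoop A B L R X := by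
  rw [gain_std A B L hR hX, blocks_stdA_add_stdB_mul A B L hR, feedbackLoop]

end StandardForm

end SDARE

end

open scoped MatrixOrder in
theorem theorem2p1 {n m l r : ℕ} [NeZero r]
    (A : Fin r → Matrix (Fin n) (Fin n) ℝ) (B : Fin r → Matrix (Fin n) (Fin m) ℝ)
    (Q : Matrix (Fin n) (Fin n) ℝ) (L : Matrix (Fin n) (Fin m) ℝ) (R : Matrix (Fin m) (Fin m) ℝ)
    (C : Matrix (Fin l) (Fin n) ℝ)
    (hQLR : (Matrix.fromBlocks Q L Lᵀ R).PosSemidef)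
    (hR : R.PosDef)
    (hstab : SDARE.Stabilizable A B)
    (hC : Cᵀ * C = Q - L * R⁻¹ * Lᵀ)
    (hdet : SDARE.Detectable (SDARE.stdABlocks A B L R) C) :
    -- the inverse in `D(Z)` exists for every `Z ⪰ 0`
    (∀ Z : Matrix (Fin n) (Fin n) ℝ, Z.PosSemidef →
      IsUnit (1 + SDARE.ltimes (SDARE.stdB B R * (SDARE.stdB B R)ᵀ) Z)) ∧
    -- monotonicity of `D`
    (∀ Z₁ Z₂ : Matrix (Fin n) (Fin n) ℝ, Z₁.PosSemidef → Z₂.PosSemidef → (Z₁ - Z₂).PosSemidef →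
      (SDARE.riccatiOp (SDARE.stdA A B L R) (SDARE.stdB B R) C Z₁ -
        SDARE.riccatiOp (SDARE.stdA A B L R) (SDARE.stdB B R) C Z₂).PosSemidef) ∧
    ∃ Xs : Matrix (Fin n) (Fin n) ℝ,
      -- `Xs` is the unique positive semi-definite stabilizing solution
      SDARE.IsPSDStabilizingSolution A B L R C Xs ∧
      (∀ X, SDARE.IsPSDStabilizingSolution A B L R C X → X = Xs) ∧
      -- the iteration is nondecreasing and converges to `Xs`
      (∀ t, (SDARE.fixedPointIter (SDARE.stdA A B L R) (SDARE.stdB B R) C (t + 1) -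
        SDARE.fixedPointIter (SDARE.stdA A B L R) (SDARE.stdB B R) C t).PosSemidef) ∧
      Tendsto (SDARE.fixedPointIter (SDARE.stdA A B L R) (SDARE.stdB B R) C) atTop (𝓝 Xs) ∧
      -- it terminates at `Xs` or increases strictly forever
      ((∃ T, ∀ t, T ≤ t →
          SDARE.fixedPointIter (SDARE.stdA A B L R) (SDARE.stdB B R) C t = Xs) ∨
        (∀ t, (SDARE.fixedPointIter (SDARE.stdA A B L R) (SDARE.stdB B R) C (t + 1) -
            SDARE.fixedPointIter (SDARE.stdA A B L R) (SDARE.stdB B R) C t).PosSemidef ∧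
          SDARE.fixedPointIter (SDARE.stdA A B L R) (SDARE.stdB B R) C (t + 1) ≠
            SDARE.fixedPointIter (SDARE.stdA A B L R) (SDARE.stdB B R) C t)) ∧
      -- error bound
      (∃ Y : Matrix (Fin n) (Fin n) ℝ, Y.PosDef ∧ IsUnit (1 - Y * Xs) ∧
        ∀ t, (SDARE.fixedPointIter (SDARE.stdA A B L R) (SDARE.stdB B R) C t -
          (Xs - ((SDARE.steinOpAdjoint (SDARE.feedbackLoop A B L R Xs)) ^ t)
            (Xs * (1 - Y * Xs)⁻¹))).PosSemidef) ∧
      -- asymptotic rate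
      (Xs ≠ 0 → ∃ ℓ : ℝ,
        Tendsto (fun t : ℕ =>
          (SDARE.inducedNorm
              (SDARE.fixedPointIter (SDARE.stdA A B L R) (SDARE.stdB B R) C t - Xs) /
            SDARE.inducedNorm Xs) ^ (1 / (t : ℝ))) atTop (𝓝 ℓ) ∧
        ENNReal.ofReal ℓ ≤ SDARE.opSpectralRadius (SDARE.steinOp (SDARE.feedbackLoop A B L R Xs))) ∧
      SDARE.opSpectralRadius (SDARE.steinOp (SDARE.feedbackLoop A B L R Xs)) < 1 := by
  have hdet' : SDARE.Detectable (SDARE.blocks (SDARE.stdA A B L R)) C := hdet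
  obtain ⟨F, hF⟩ := hstab
  rw [← SDARE.blocks_stdA_add_stdB_mul A B L hR F] at hF
  set A' := SDARE.stdA A B L R with hA'
  set B' := SDARE.stdB B R with hB'
  obtain ⟨X, hX, hfix, hlim⟩ := SDARE.exists_tendsto_fixedPointIter A' B' C hF
  have hst := SDARE.opSpectralRadius_closedLoop_lt_one A' B' C hdet' hX hfix
  have hloop : SDARE.blocks (A' + B' * SDARE.gain A' B' X) = SDARE.feedbackLoop A B L R X :=
    SDARE.blocks_closedLoop_std A B L hR hX
  have hmono := SDARE.fixedPointIter_le_succ A' B' C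
  refine ⟨fun Z hZ => ?_, fun Z₁ Z₂ hZ₁ hZ₂ h => ?_, X, ⟨?_, hfix, hloop ▸ hst⟩, ?_, hmono, hlim,
    ?_, ?_, ?_, hloop ▸ hst⟩
  · exact SDARE.isUnit_one_add_ltimes B' (Matrix.nonneg_iff_posSemidef.mpr hZ)
  · exact SDARE.riccatiOp_mono A' B' C (Matrix.nonneg_iff_posSemidef.mpr hZ₂) h
  · exact Matrix.nonneg_iff_posSemidef.mp hX
  · rintro Z ⟨hZ, hZfix, hZst⟩
    have hZ0 := Matrix.nonneg_iff_posSemidef.mpr hZ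
    rw [← SDARE.blocks_closedLoop_std A B L hR hZ0] at hZst
    exact le_antisymm (SDARE.le_of_stabilizing A' B' C hX hfix hst hZ0 hZfix)
      (SDARE.le_of_stabilizing A' B' C hZ0 hZfix hZst hX hfix)
  · by_cases hT : ∃ T, SDARE.fixedPointIter A' B' C (T + 1) = SDARE.fixedPointIter A' B' C T
    · obtain ⟨T, hT⟩ := hT
      have hconst : ∀ t, T ≤ t →
          SDARE.fixedPointIter A' B' C t = SDARE.fixedPointIter A' B' C T := fun t ht =>
        SDARE.fixedPointIter_eq_of_succ_eq A' B' C hT ht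
      have hTX : SDARE.fixedPointIter A' B' C T = X :=
        tendsto_nhds_unique (tendsto_const_nhds.congr'
          (eventually_atTop.mpr ⟨T, fun t ht => (hconst t ht).symm⟩)) hlim
      exact Or.inl ⟨T, fun t ht => (hconst t ht).trans hTX⟩
    · push Not at hT
      exact Or.inr fun t => ⟨hmono t, hT t⟩
  · obtain ⟨κ, hκ, hbound⟩ := SDARE.exists_error_le_pow hX hfix hlim hst
    obtain ⟨Y, hY, hunit, hYX⟩ := SDARE.exists_posDef_mul_inv_eq_smul hX hκ
    refine ⟨Y, hY, hunit, fun t => ?_⟩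
    rw [hYX, map_smul, ← hloop]
    exact sub_le_comm.mp (hbound t)
  · intro hne
    rw [← hloop]
    exact SDARE.exists_tendsto_error_rpow hX hfix hlim hst hne
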